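/- Let $F$ be a differential field of characteristic zero with derivation $\partial$ and field of constants $K=\{f\in F:\partial f=0\}$. A Picard–Vessiot extension $E/F$ is a differential field extension such that $E=F(W_{ij})$ for some $W\in\mathrm{GL}_n(E)$ with $\partial W=AW$, $A\in M_n(F)$, and such that the field of constants of $E$ is $K$. For a $K$-algebra $S$ and a differential $F$-algebra $A$ put $A_S=A\otimes_K S$, with $\partial(a\otimes s)=\partial(a)\otimes s$. Let $E/F$ be a Picard–Vessiot extension generated by the fundamental matrix $W$, let $R=F[W_{ij},\det(W)^{-1}]\subset E$ be its Picard–Vessiot ring, and let $G$ be the $\partial$-Galois group, i.e. the group functor $S\mapsto \mathrm{Aut}^\partial(R_S/F_S)$ on $K$-algebras. Let $L/K$ be a (possibly infinite) algebraic Galois extension with Galois group $\Gamma$, acting on $G(L)$ by functoriality, i.e. $({}^\sigma\varphi)=(1\otimes\sigma)\circ\varphi\circ(1\otimes\sigma)^{-1}$. An $L/K$-form of $E/F$ is a Picard–Vessiot extension $E'/F$ such that $E_L$ and $E'_L$ are isomorphic as differential rings over $F_L$; two forms are isomorphic if they are isomorphic as differential rings over $F$. Let $H^1(\Gamma,G(L))$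 be the pointed set of continuous $1$-cocycles $a:\Gamma\to G(L)$ ($a_{\sigma\tau}=a_\sigma\,{}^\sigma a_\tau$, with $\Gamma$ profinite and $G(L)$ discrete) modulo $a_\sigma\sim g^{-1}a_\sigma\,{}^\sigma g$, $g\in G(L)$. Then $H^1(\Gamma,G(L))$ classifies the isomorphism classes of $L/K$-forms of $E/F$: there is a bijection from the set of isomorphism classes of $L/K$-forms of $E/F$ to $H^1(\Gamma,G(L))$ that sends the class of $E$ to the base point and that sends the class of a form $E'$, for every isomorphism $f:E_L\to E'_L$ of differential rings over $F_L$, to the class of the continuous cocycle $a$ determined by $$a_\sigma = f^{-1}\circ(1\otimes\sigma)\circ f\circ(1\otimes\sigma)^{-1}\big|_{R_L}\qquad(\sigma\in\Gamma).$$ In particular, the right-hand side maps $R_L$ to itself and lies in $G(L)$. -/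

import Mathlib

open scoped TensorProduct Differential

universe u v w

noncomputable section

namespace PicardVessiot

/-! ### Differential rings over a base -/

/-- An isomorphism between the objects `i : T → A` and `j : T → B` of the category of differential
rings under `T`: a ring isomorphism commuting with the derivations and with the structure maps. -/
structure DRingIso {T : Type*} {A : Type*} {B : Type*} [CommRing T] [CommRing A] [CommRing B]
    [Differential A] [Differential B] (i : T →+* A) (j : T →+* B) extends A ≃+* B where
  map_deriv : ∀ x : A, toFun x′ = ((toFun x)′)
  map_base : ∀ t : T, toFun (i t) = j t

namespace DRingIso

variable {T : Type*} {A : Type*} {B : Type*} {C : Type*} [CommRing T] [CommRing A] [CommRing B]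
  [CommRing C] [Differential A] [Differential B] [Differential C]
  {i : T →+* A} {j : T →+* B} {k : T →+* C}

instance : CoeFun (DRingIso i j) (fun _ => A → B) := ⟨fun f => f.toRingEquiv⟩

theorem ext_apply {f g : DRingIso i j} (h : ∀ x, f x = g x) : f = g := by
  obtain ⟨f, _, _⟩ := f
  obtain ⟨g, _, _⟩ := g
  have : f = g := RingEquiv.ext h
  subst this
  rfl

theorem apply_deriv (f : DRingIso i j) (x : A) : f x′ = (f x)′ := f.map_deriv x

theorem apply_base (f : DRingIso i j) (t : T) : f (i t) = j t := f.map_base t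

/-- The identity. -/
def refl (i : T →+* A) : DRingIso i i where
  toRingEquiv := RingEquiv.refl A
  map_deriv _ := rfl
  map_base _ := rfl

/-- The inverse isomorphism. -/
def symm (f : DRingIso i j) : DRingIso j i where
  toRingEquiv := f.toRingEquiv.symm
  map_deriv x := by
    change f.toRingEquiv.symm (x′) = ((f.toRingEquiv.symm x)′)
    rw [RingEquiv.symm_apply_eq]
    have h := f.apply_deriv (f.toRingEquiv.symm x)
    rw [h, RingEquiv.apply_symm_apply]
  map_base t := by
    change f.toRingEquiv.symm (j t) = i t
    rw [RingEquiv.symm_apply_eq]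
    exact (f.apply_base t).symm

/-- The composite `g ∘ f`. -/
def trans (f : DRingIso i j) (g : DRingIso j k) : DRingIso i k where
  toRingEquiv := f.toRingEquiv.trans g.toRingEquiv
  map_deriv x := by
    change g (f (x′)) = ((g (f x))′)
    rw [f.apply_deriv, g.apply_deriv]
  map_base t := by
    change g (f (i t)) = k t
    rw [f.apply_base, g.apply_base]

/-- Automorphisms form a group, with `(f * g) x = f (g x)`. -/
instance : Group (DRingIso i i) where
  mul f g := g.trans f
  one := refl i
  inv f := f.symm
  mul_assoc _ _ _ := rfl
  one_mul _ := rfl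
  mul_one _ := rfl
  inv_mul_cancel f := ext_apply fun x => f.toRingEquiv.symm_apply_apply x

theorem mul_apply (f g : DRingIso i i) (x : A) : (f * g) x = f (g x) := rfl

theorem one_apply (x : A) : (1 : DRingIso i i) x = x := rfl

end DRingIso

/-! ### Constants and base change along algebras over the constants -/

section BaseChange

variable (F : Type u) [Field F] [Differential F]

/-- The field of constants `{f ∈ F | f′ = 0}`. -/
def constants : Subfield F where
  carrier := {x | x′ = 0}
  mul_mem' {a b} ha hb := by
    simp only [Set.mem_ofPred_eq] at *
    rw [Derivation.leibniz, ha, hb]; simp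
  one_mem' := by simp
  add_mem' {a b} ha hb := by
    simp only [Set.mem_ofPred_eq] at *
    rw [map_add, ha, hb, add_zero]
  zero_mem' := by simp
  neg_mem' {a} ha := by
    simp only [Set.mem_ofPred_eq] at *
    rw [map_neg, ha, neg_zero]
  inv_mem' a ha := by
    simp only [Set.mem_ofPred_eq] at *
    rw [Derivation.leibniz_inv, ha, smul_zero]

variable (A : Type v) [CommRing A] [Differential A] [Algebra F A] [DifferentialAlgebra F A]

/-- The derivation of a differential `F`-algebra as a linear map over the constants of `F`. -/
def derivLinear : A →ₗ[constants F] A where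
  toFun a := (a′)
  map_add' a b := map_add _ a b
  map_smul' c a := by
    have hc : (algebraMap F A (c : F))′ = 0 := by
      rw [DifferentialAlgebra.deriv_algebraMap, show ((c : F))′ = 0 from c.2, map_zero]
    have h1 : ∀ b : A, c • b = algebraMap F A (c : F) * b := fun b => Algebra.smul_def (c : F) b
    simp only [h1, RingHom.id_apply]
    rw [Derivation.leibniz, hc]
    simp

variable (S : Type w) [CommRing S] [Algebra (constants F) S]

/-- `A_S = A ⊗ S`, the tensor product over the constants of `F`. -/
abbrev BaseChange : Type (max v w) := A ⊗[constants F] S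

/-- The derivation `∂ ⊗ 1` of `A_S`: the algebra `S` over the constants carries the derivation 0. -/
instance : Differential (BaseChange F A S) where
  deriv := Derivation.mk' ((LinearMap.rTensor S (derivLinear F A)).toAddMonoidHom.toIntLinearMap) (by
    intro x y
    change LinearMap.rTensor S (derivLinear F A) (x * y) =
      x * LinearMap.rTensor S (derivLinear F A) y + y * LinearMap.rTensor S (derivLinear F A) x
    induction x using TensorProduct.induction_on with
    | zero => simp
    | add x₁ x₂ h₁ h₂ => rw [add_mul, map_add, h₁, h₂, map_add]; ring
    | tmul a s =>
      induction y using TensorProduct.induction_on with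
      | zero => simp
      | add y₁ y₂ h₁ h₂ => rw [mul_add, map_add, h₁, h₂, map_add]; ring
      | tmul b t =>
        simp only [Algebra.TensorProduct.tmul_mul_tmul, LinearMap.rTensor_tmul]
        have : derivLinear F A (a * b) = a * derivLinear F A b + b * derivLinear F A a :=
          Derivation.leibniz Differential.deriv a b
        rw [this, TensorProduct.add_tmul, mul_comm t s])

theorem deriv_tmul (a : A) (s : S) : (a ⊗ₜ[constants F] s : BaseChange F A S)′ = a′ ⊗ₜ s := rfl

/-- The structure map `F_S → A_S`, `f ⊗ s ↦ f ⊗ s`. -/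
def baseMap : BaseChange F F S →+* BaseChange F A S :=
  (Algebra.TensorProduct.map
    ((Algebra.ofId F A).restrictScalars (constants F)) (AlgHom.id (constants F) S)).toRingHom

theorem baseMap_tmul (f : F) (s : S) :
    baseMap F A S (f ⊗ₜ s) = algebraMap F A f ⊗ₜ s := by
  simp [baseMap, Algebra.ofId_apply]

/-- The map `A_S → A_S'` induced by a homomorphism `S → S'` of algebras over the constants. -/
def extend {S : Type*} {S' : Type*} [CommRing S] [Algebra (constants F) S]
    [CommRing S'] [Algebra (constants F) S'] (f : S →ₐ[constants F] S') :
    BaseChange F A S →ₐ[constants F] BaseChange F A S' :=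
  Algebra.TensorProduct.map (AlgHom.id (constants F) A) f

theorem extend_tmul {S : Type*} {S' : Type*} [CommRing S] [Algebra (constants F) S]
    [CommRing S'] [Algebra (constants F) S'] (f : S →ₐ[constants F] S') (a : A) (s : S) :
    extend F A f (a ⊗ₜ s) = a ⊗ₜ f s := by simp [extend]

/-- The value at `S` of the group functor of differential automorphisms of `A/F`:
the group of automorphisms of `A_S` in differential rings under `F_S`. -/
abbrev DAut : Type (max v w) := DRingIso (baseMap F A S) (baseMap F A S)

end BaseChange

/-! ### Functoriality of `DAut` in the algebra over the constants -/

namespace DAut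

variable {F : Type u} [Field F] [Differential F]
  {A : Type v} [CommRing A] [Differential A] [Algebra F A] [DifferentialAlgebra F A]
  {S : Type*} [CommRing S] [Algebra (constants F) S]
  {S' : Type*} [CommRing S'] [Algebra (constants F) S']

theorem apply_one_tmul (φ : DAut F A S) (s : S) : φ ((1 : A) ⊗ₜ s) = (1 : A) ⊗ₜ s := by
  have h := φ.apply_base ((1 : F) ⊗ₜ s)
  rwa [baseMap_tmul, map_one] at h

/-- An element of `DAut F A S` as an algebra homomorphism over the constants. -/
def toAlgHom (φ : DAut F A S) :
    BaseChange F A S →ₐ[constants F] BaseChange F A S :=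
  AlgHom.mk (φ.toRingEquiv : BaseChange F A S →+* BaseChange F A S) (by
    intro c
    change φ (algebraMap _ _ c) = algebraMap _ _ c
    have h : algebraMap (constants F) (BaseChange F A S) c = (1 : A) ⊗ₜ algebraMap _ S c :=
      Algebra.TensorProduct.algebraMap_apply' c
    rw [h, apply_one_tmul])

/-- The unique `S'`-linear endomorphism of `A_S'` extending `φ`. -/
def mapHom (f : S →ₐ[constants F] S') (φ : DAut F A S) :
    BaseChange F A S' →ₐ[constants F] BaseChange F A S' :=
  Algebra.TensorProduct.lift
    (((extend F A f).comp (toAlgHom φ)).comp Algebra.TensorProduct.includeLeft)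
    Algebra.TensorProduct.includeRight (fun _ _ => Commute.all _ _)

theorem mapHom_tmul (f : S →ₐ[constants F] S') (φ : DAut F A S) (a : A) (s : S') :
    mapHom f φ (a ⊗ₜ s) = extend F A f (φ (a ⊗ₜ 1)) * ((1 : A) ⊗ₜ s) := by
  simp [mapHom, toAlgHom]

theorem mapHom_extend (f : S →ₐ[constants F] S') (φ : DAut F A S) (x : BaseChange F A S) :
    mapHom f φ (extend F A f x) = extend F A f (φ x) := by
  induction x using TensorProduct.induction_on with
  | zero =>
    have : φ (0 : BaseChange F A S) = 0 := map_zero φ.toRingEquiv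
    rw [this, map_zero, map_zero]
  | add x y hx hy =>
    have : φ (x + y) = φ x + φ y := map_add φ.toRingEquiv x y
    rw [this, map_add, map_add, map_add, hx, hy]
  | tmul a s =>
    have h : (a ⊗ₜ s : BaseChange F A S) = (a ⊗ₜ 1) * ((1 : A) ⊗ₜ s) := by simp
    have h2 : φ (a ⊗ₜ s) = φ (a ⊗ₜ 1) * ((1 : A) ⊗ₜ s) := by
      have h3 : φ ((a ⊗ₜ 1 : BaseChange F A S) * ((1 : A) ⊗ₜ s)) =
        φ (a ⊗ₜ 1) * φ ((1 : A) ⊗ₜ s) := map_mul φ.toRingEquiv _ _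
      rw [h, h3, apply_one_tmul]
    rw [extend_tmul, mapHom_tmul, h2, map_mul, extend_tmul]

theorem mapHom_mapHom (f : S →ₐ[constants F] S') (φ ψ : DAut F A S) (x : BaseChange F A S') :
    mapHom f φ (mapHom f ψ x) = mapHom f (φ * ψ) x := by
  induction x using TensorProduct.induction_on with
  | zero => simp
  | add x y hx hy => simp only [map_add, hx, hy]
  | tmul a s =>
    rw [mapHom_tmul, mapHom_tmul, map_mul, mapHom_extend, mapHom_tmul, DRingIso.mul_apply]
    congr 1
    have : φ (1 : BaseChange F A S) = 1 := map_one φ.toRingEquiv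
    rw [← Algebra.TensorProduct.one_def, this, map_one, one_mul]

theorem mapHom_one (f : S →ₐ[constants F] S') (x : BaseChange F A S') :
    mapHom f (1 : DAut F A S) x = x := by
  induction x using TensorProduct.induction_on with
  | zero => simp
  | add x y hx hy => simp only [map_add, hx, hy]
  | tmul a s => rw [mapHom_tmul, DRingIso.one_apply, extend_tmul]; simp

theorem extend_deriv (f : S →ₐ[constants F] S') (x : BaseChange F A S) :
    extend F A f x′ = (extend F A f x)′ := by
  induction x using TensorProduct.induction_on with
  | zero => simp
  | add x y hx hy => simp only [map_add, hx, hy]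
  | tmul a s => rw [deriv_tmul, extend_tmul, extend_tmul, deriv_tmul]

theorem mapHom_deriv (f : S →ₐ[constants F] S') (φ : DAut F A S) (x : BaseChange F A S') :
    mapHom f φ x′ = (mapHom f φ x)′ := by
  induction x using TensorProduct.induction_on with
  | zero => simp
  | add x y hx hy => simp only [map_add, hx, hy]
  | tmul a s =>
    rw [deriv_tmul, mapHom_tmul, mapHom_tmul, Derivation.leibniz, deriv_tmul, ← extend_deriv,
      ← φ.apply_deriv, deriv_tmul]
    simp [mul_comm]

/-- Functoriality: a homomorphism `f : S → S'` sends an automorphism of `A_S` to its base change,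
the automorphism of `A_S'` that restricts to it along `A_S → A_S'`. -/
def map (f : S →ₐ[constants F] S') : DAut F A S →* DAut F A S' where
  toFun φ :=
    { toRingEquiv := RingEquiv.ofRingHom (mapHom f φ).toRingHom (mapHom f φ⁻¹).toRingHom
        (RingHom.ext fun x => by
          change mapHom f φ (mapHom f φ⁻¹ x) = x
          rw [mapHom_mapHom, mul_inv_cancel, mapHom_one])
        (RingHom.ext fun x => by
          change mapHom f φ⁻¹ (mapHom f φ x) = x
          rw [mapHom_mapHom, inv_mul_cancel, mapHom_one])
      map_deriv := mapHom_deriv f φ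
      map_base := by
        intro t
        change mapHom f φ (baseMap F A S' t) = baseMap F A S' t
        induction t using TensorProduct.induction_on with
        | zero => simp
        | add x y hx hy => simp only [map_add, hx, hy]
        | tmul a s =>
          have h := φ.apply_base (a ⊗ₜ (1 : S))
          rw [baseMap_tmul] at h
          rw [baseMap_tmul, mapHom_tmul, h, extend_tmul]
          simp }
  map_one' := DRingIso.ext_apply fun x => mapHom_one f x
  map_mul' φ ψ := DRingIso.ext_apply fun x => (mapHom_mapHom f φ ψ x).symm

theorem map_apply_tmul (f : S →ₐ[constants F] S') (φ : DAut F A S) (a : A) (s : S') :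
    map f φ (a ⊗ₜ s) = extend F A f (φ (a ⊗ₜ 1)) * ((1 : A) ⊗ₜ s) := mapHom_tmul f φ a s

theorem map_apply_extend (f : S →ₐ[constants F] S') (φ : DAut F A S) (x : BaseChange F A S) :
    map f φ (extend F A f x) = extend F A f (φ x) := mapHom_extend f φ x

theorem extend_id (x : BaseChange F A S) : extend F A (AlgHom.id (constants F) S) x = x := by
  simp [extend]

theorem extend_comp {S'' : Type*} [CommRing S''] [Algebra (constants F) S'']
    (g : S' →ₐ[constants F] S'') (f : S →ₐ[constants F] S') (x : BaseChange F A S) :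
    extend F A (g.comp f) x = extend F A g (extend F A f x) := by
  induction x using TensorProduct.induction_on with
  | zero => simp
  | add x y hx hy => simp only [map_add, hx, hy]
  | tmul a s => simp [extend_tmul]

theorem map_id (φ : DAut F A S) : map (AlgHom.id (constants F) S) φ = φ :=
  DRingIso.ext_apply fun x => by
    have h := map_apply_extend (AlgHom.id (constants F) S) φ x
    rwa [extend_id, extend_id] at h

theorem map_comp {S'' : Type*} [CommRing S''] [Algebra (constants F) S'']
    (g : S' →ₐ[constants F] S'') (f : S →ₐ[constants F] S') (φ : DAut F A S) :
    map (g.comp f) φ = map g (map f φ) :=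
  DRingIso.ext_apply fun x => by
    induction x using TensorProduct.induction_on with
    | zero =>
      have h1 : map (g.comp f) φ 0 = 0 := map_zero (map (g.comp f) φ).toRingEquiv
      have h2 : map g (map f φ) 0 = 0 := map_zero (map g (map f φ)).toRingEquiv
      rw [h1, h2]
    | add x y hx hy =>
      have h1 : map (g.comp f) φ (x + y) = map (g.comp f) φ x + map (g.comp f) φ y :=
        map_add (map (g.comp f) φ).toRingEquiv x y
      have h2 : map g (map f φ) (x + y) = map g (map f φ) x + map g (map f φ) y :=
        map_add (map g (map f φ)).toRingEquiv x y
      rw [h1, h2, hx, hy]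
    | tmul a s =>
      rw [map_apply_tmul, map_apply_tmul, map_apply_tmul, ← Algebra.TensorProduct.one_def,
        mul_one, extend_comp]

/-- The action `σ ↦ 1 ⊗ σ` of `Γ = Gal(L/K)` on `A_L`, where `K` is the field of constants. -/
def galMap {L : Type*} [Field L] [Algebra (constants F) L] (σ : Gal(L/constants F)) :
    BaseChange F A L → BaseChange F A L :=
  extend F A (σ : L →ₐ[constants F] L)

/-- The action of `Γ = Gal(L/K)` on the `L`-points, by functoriality. Since
`map σ φ (σ x) = σ (φ x)`, it is conjugation `φ ↦ σ ∘ φ ∘ σ⁻¹` inside the automorphisms of `A_L`. -/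
instance galAction {L : Type*} [Field L] [Algebra (constants F) L] :
    MulDistribMulAction Gal(L/constants F) (DAut F A L) where
  smul σ φ := map (σ : L →ₐ[constants F] L) φ
  one_smul φ := map_id φ
  mul_smul σ τ φ := map_comp (σ : L →ₐ[constants F] L) (τ : L →ₐ[constants F] L) φ
  smul_mul σ φ ψ := map_mul (map (σ : L →ₐ[constants F] L)) φ ψ
  smul_one σ := map_one (map (σ : L →ₐ[constants F] L))

theorem smul_def {L : Type*} [Field L] [Algebra (constants F) L] (σ : Gal(L/constants F))
    (φ : DAut F A L) : σ • φ = map (σ : L →ₐ[constants F] L) φ := rfl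

theorem smul_apply_galMap {L : Type*} [Field L] [Algebra (constants F) L]
    (σ : Gal(L/constants F)) (φ : DAut F A L) (x : BaseChange F A L) :
    (σ • φ) (galMap σ x) = galMap σ (φ x) := map_apply_extend _ φ x

end DAut

/-! ### Picard–Vessiot extensions and the differential Galois group -/

section PV

variable (F : Type u) [Field F] [Differential F]
  (E : Type v) [Field E] [Differential E] [Algebra F E] [DifferentialAlgebra F E]

/-- A fundamental solution matrix in `E` of some linear equation `w′ = A w` over `F`:
`W ∈ GL_n(E)` with `W′ = A W`, where `A ∈ M_n(F)`. -/
structure FundamentalMatrix where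
  n : ℕ
  A : Matrix (Fin n) (Fin n) F
  W : Matrix (Fin n) (Fin n) E
  det_ne_zero : W.det ≠ 0
  deriv_eq : W.map (fun x => x′) = A.map (algebraMap F E) * W

namespace FundamentalMatrix

variable {F E}

/-- `E = F(W_{ij})`. -/
def Generates (X : FundamentalMatrix F E) : Prop :=
  IntermediateField.adjoin F (Set.range fun p : Fin X.n × Fin X.n => X.W p.1 p.2) = ⊤

/-- The Picard–Vessiot ring `R = F[W, W⁻¹] = F[W_{ij}, det(W)⁻¹] ⊆ E`. -/
def ring (X : FundamentalMatrix F E) : Subalgebra F E :=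
  Algebra.adjoin F (Set.range (fun p : Fin X.n × Fin X.n => X.W p.1 p.2) ∪ {(X.W.det)⁻¹})

theorem adjoin_deriv_mem {s : Set E} {R : Subalgebra F E} (hs : Algebra.adjoin F s ≤ R)
    (h : ∀ x ∈ s, x′ ∈ R) {x : E} (hx : x ∈ Algebra.adjoin F s) : x′ ∈ R := by
  induction hx using Algebra.adjoin_induction with
  | mem x hx => exact h x hx
  | algebraMap r => rw [DifferentialAlgebra.deriv_algebraMap]; exact R.algebraMap_mem _
  | add x y _ _ h₁ h₂ => rw [map_add]; exact R.add_mem h₁ h₂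
  | mul x y hx hy h₁ h₂ =>
    rw [Derivation.leibniz]
    exact R.add_mem (R.mul_mem (hs hx) h₂) (R.mul_mem (hs hy) h₁)

theorem deriv_entry (X : FundamentalMatrix F E) (i j : Fin X.n) :
    (X.W i j)′ = ∑ k, algebraMap F E (X.A i k) * X.W k j := by
  have h := congrFun (congrFun X.deriv_eq i) j
  simpa [Matrix.mul_apply] using h

theorem deriv_mem (X : FundamentalMatrix F E) {x : E} (hx : x ∈ X.ring) : x′ ∈ X.ring := by
  have hW : ∀ i j, X.W i j ∈ X.ring := fun i j =>
    Algebra.subset_adjoin (Or.inl ⟨(i, j), rfl⟩)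
  have hW' : ∀ i j, (X.W i j)′ ∈ X.ring := fun i j => by
    rw [X.deriv_entry]
    exact X.ring.sum_mem fun k _ => X.ring.mul_mem (X.ring.algebraMap_mem _) (hW k j)
  have hd : X.W.det ∈ Algebra.adjoin F
      (Set.range fun p : Fin X.n × Fin X.n => X.W p.1 p.2) := by
    rw [Matrix.det_apply']
    refine Subalgebra.sum_mem _ fun σ _ => Subalgebra.mul_mem _ (Subalgebra.intCast_mem _ _) ?_
    exact Subalgebra.prod_mem _ fun i _ => Algebra.subset_adjoin ⟨(σ i, i), rfl⟩
  have hd' : (X.W.det)′ ∈ X.ring :=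
    adjoin_deriv_mem (Algebra.adjoin_mono Set.subset_union_left)
      (by rintro _ ⟨p, rfl⟩; exact hW' _ _) hd
  have hi : (X.W.det)⁻¹ ∈ X.ring := Algebra.subset_adjoin (Or.inr rfl)
  refine adjoin_deriv_mem (R := X.ring) le_rfl ?_ hx
  rintro y (⟨p, rfl⟩ | rfl)
  · exact hW' _ _
  · rw [Derivation.leibniz_inv]
    exact X.ring.mul_mem (X.ring.neg_mem (X.ring.pow_mem hi 2)) hd'

/-- The derivation of `E` restricts to the Picard–Vessiot ring. -/
instance (X : FundamentalMatrix F E) : Differential X.ring where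
  deriv := Derivation.mk'
    { toFun := fun x => ⟨(x : E)′, X.deriv_mem x.2⟩
      map_add' := fun x y => Subtype.ext (map_add _ (x : E) (y : E))
      map_smul' := fun c x => Subtype.ext (by
        change (c • (x : E))′ = c • ((x : E)′)
        exact Derivation.map_smul _ c (x : E)) }
    (fun x y => Subtype.ext (Derivation.leibniz _ (x : E) (y : E)))

instance (X : FundamentalMatrix F E) : DifferentialAlgebra F X.ring where
  deriv_algebraMap a := Subtype.ext (DifferentialAlgebra.deriv_algebraMap (B := E) a)

/-- The inclusion `R_S → E_S`. -/
def incl (X : FundamentalMatrix F E) (S : Type w) [CommRing S] [Algebra (constants F) S] :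
    BaseChange F X.ring S →+* BaseChange F E S :=
  (Algebra.TensorProduct.map (X.ring.val.restrictScalars (constants F))
    (AlgHom.id (constants F) S)).toRingHom

end FundamentalMatrix

/-- The differential field extension `E/F` is a Picard–Vessiot extension: it is generated by a
fundamental solution matrix of a linear equation over `F`, and every constant of `E` is a
constant of `F`. -/
def IsPicardVessiot : Prop :=
  (∃ X : FundamentalMatrix F E, X.Generates) ∧
    ∀ x : E, x′ = 0 → ∃ c : constants F, algebraMap (constants F) E c = x

variable {F E}

/-- The `S`-points `G(S)` of the differential Galois group `G = Gal(R/F)` of a Picard–Vessiot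
extension `E/F` generated by the fundamental matrix `W`, with Picard–Vessiot ring `R = F[W, W⁻¹]`:
the group functor `S ↦ Aut(R_S/F_S)` on algebras over the constants. -/
abbrev FundamentalMatrix.GaloisGroup (X : FundamentalMatrix F E) (S : Type w) [CommRing S]
    [Algebra (constants F) S] : Type (max v w) :=
  DAut F X.ring S

end PV

/-! ### Nonabelian cohomology -/

section Cohomology

variable (Γ : Type u) [Group Γ] [TopologicalSpace Γ] (M : Type v) [Group M]
  [MulDistribMulAction Γ M]

/-- Continuous 1-cocycles of `Γ` with values in the discrete group `M`. -/
structure Cocycle where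
  toFun : Γ → M
  isLocallyConstant : IsLocallyConstant toFun
  map_mul : ∀ σ τ, toFun (σ * τ) = toFun σ * σ • toFun τ

/-- `a` and `b` are cohomologous if `b_σ = g⁻¹ a_σ σ(g)` for some `g ∈ M`. -/
instance Cocycle.setoid : Setoid (Cocycle Γ M) where
  r a b := ∃ g : M, ∀ σ, b.toFun σ = g⁻¹ * a.toFun σ * σ • g
  iseqv :=
    { refl := fun a => ⟨1, fun σ => by simp⟩
      symm := by
        rintro a b ⟨g, h⟩
        exact ⟨g⁻¹, fun σ => by rw [h σ]; simp [mul_assoc]⟩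
      trans := by
        rintro a b c ⟨g, h⟩ ⟨k, h'⟩
        exact ⟨g * k, fun σ => by rw [h' σ, h σ]; simp [mul_assoc]⟩ }

/-- The pointed set `H¹(Γ, M)`. -/
abbrev H1 : Type (max u v) := Quotient (Cocycle.setoid Γ M)

/-- The trivial cocycle. -/
def Cocycle.trivial : Cocycle Γ M where
  toFun _ := 1
  isLocallyConstant := IsLocallyConstant.const 1
  map_mul σ τ := by simp

/-- The base point of `H¹(Γ, M)`. -/
def H1.basePoint : H1 Γ M := Quotient.mk _ (Cocycle.trivial Γ M)

end Cohomology

/-! ### Forms -/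

section Forms

variable (F : Type u) [Field F] [Differential F]
  (E : Type u) [Field E] [Differential E] [Algebra F E] [DifferentialAlgebra F E]
  (L : Type v) [Field L] [Algebra (constants F) L]

/-- The `L/K`-forms of `E/F`: Picard–Vessiot extensions `E'/F` such that `E_L` and `E'_L` are
isomorphic as differential rings under `F_L`. -/
structure Form where
  carrier : Type u
  [field : Field carrier]
  [differential : Differential carrier]
  [algebra : Algebra F carrier]
  [differentialAlgebra : DifferentialAlgebra F carrier]
  isPicardVessiot : IsPicardVessiot F carrier
  isForm : Nonempty (DRingIso (baseMap F E L) (baseMap F carrier L))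

attribute [instance] Form.field Form.differential Form.algebra Form.differentialAlgebra

/-- Two forms are isomorphic if they are isomorphic as differential rings under `F`. -/
instance Form.setoid : Setoid (Form F E L) where
  r E₁ E₂ := Nonempty (DRingIso (algebraMap F E₁.carrier) (algebraMap F E₂.carrier))
  iseqv :=
    { refl := fun _ => ⟨DRingIso.refl _⟩
      symm := fun ⟨f⟩ => ⟨f.symm⟩
      trans := fun ⟨f⟩ ⟨g⟩ => ⟨f.trans g⟩ }

/-- The set of isomorphism classes of `L/K`-forms of `E/F`. -/
abbrev FormClasses : Type (u + 1) := Quotient (Form.setoid F E L)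

variable {E}

/-- `E` as a form of itself. -/
def Form.self (hE : IsPicardVessiot F E) : Form F E L where
  carrier := E
  isPicardVessiot := hE
  isForm := ⟨DRingIso.refl _⟩

end Forms

end PicardVessiot

end

open PicardVessiot

/-! This is Galois descent, with Hilbert's Theorem 90 for `GL_n` producing the forms. Write K for
the constants of F, Γ for Gal(L/K), and V for the matrix W ⊗ 1 over `E_L`.

Taking coordinates in a K-basis of L shows that the constants of `E_L` are exactly L. Two
consequences follow. An idempotent of `E_L` is constant, hence 0 or 1; as `E_L` is reduced and
integral over E, it is a field (`isField_baseChange`). And a differential automorphism of `E_L` over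
`F_L` sends V to V C with C in GL_n(L) (`exists_matrix_map_eq`), so it preserves `R_L`. Since `E_L`
is the fraction field of `R_L`, restriction identifies the automorphisms of `E_L` with G(L),
compatibly with Γ (`exists_restrictEquiv`). The cocycles can therefore be studied on `E_L`.

Composing f with an automorphism g of `E_L` changes its cocycle by the coboundary of g, and an
isomorphism of forms over F commutes with Γ after base change, so the class is well defined. If two
forms have cohomologous cocycles, the isomorphisms can be adjusted so that the resulting map between
the forms over L commutes with Γ; it then descends to F by taking invariants
(`nonempty_iso_of_twist_eq`).

For surjectivity (`exists_form_of_cocycle`), a cocycle a gives the twisted action ρ_σ = a_σ ∘ (1 ⊗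
σ) on `E_L`, and ρ_σ(V) = V C_σ for a matrix cocycle C. Hilbert 90 (`exists_matrix_of_cocycle`)
gives an invertible B with C_σ σ(B) = B. Then V B is fixed by ρ and solves the same equation as V,
and the subfield it generates over F is a form with cocycle a. -/

noncomputable section

namespace PicardVessiot

/-! ### Hilbert's Theorem 90 for continuous matrix cocycles -/

section Hilbert90

open Matrix

theorem exists_algEquiv_extending {K L : Type*} [Field K] [Field L] [Algebra K L] [Normal K L]
    (M : IntermediateField K L) (s : M →ₐ[K] L) : ∃ σ : Gal(L/K), ∀ m : M, σ m = s m := by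
  obtain ⟨φ, hφ⟩ := IntermediateField.exists_algHom_of_splits
    (fun x : L => ⟨Algebra.IsIntegral.isIntegral x, Normal.splits inferInstance x⟩) s
  refine ⟨AlgEquiv.ofBijective φ (Algebra.IsAlgebraic.algHom_bijective φ), fun m => ?_⟩
  exact DFunLike.congr_fun hφ m

/-- **Hilbert's Theorem 90** for `GL_n` and a possibly infinite Galois extension: a continuous
1-cocycle with values in invertible matrices is a coboundary. -/
theorem exists_matrix_of_cocycle {K L : Type*} [Field K] [Field L] [Algebra K L] [Normal K L]
    {n : ℕ} (C : Gal(L/K) → Matrix (Fin n) (Fin n) L)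
    (hmul : ∀ σ τ, C (σ * τ) = C σ * (C τ).map σ)
    (hone : ∀ᶠ σ in nhds (1 : Gal(L/K)), C σ = 1) :
    ∃ B : Matrix (Fin n) (Fin n) L, B.det ≠ 0 ∧ ∀ σ, C σ * B.map σ = B := by
  -- C is trivial on the automorphisms fixing some finite subextension M. Hence C σ depends only on
  -- the restriction of σ to M, and finite sums over embeddings of M replace averages over Γ.
  obtain ⟨M, hM, hU⟩ := (krullTopology_mem_nhds_one_iff K L _).1 hone
  choose ℓ hℓ using exists_algEquiv_extending M
  have hinv : ∀ σ τ : Gal(L/K), (∀ m : M, σ m = τ m) → C σ = C τ := by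
    intro σ τ h
    have h1 : C (τ⁻¹ * σ) = 1 := hU fun m => by
      change τ.symm (σ m) = m
      rw [h, AlgEquiv.symm_apply_apply]
    have h2 := hmul τ (τ⁻¹ * σ)
    rw [h1, mul_inv_cancel_left] at h2
    rw [h2]
    ext i j
    simp [Matrix.map_one]
  -- S consists of the vectors fixed by the twisted action, and `b v` is a twisted trace.
  -- Composition with τ permutes the embeddings of M, so every such trace lies in S.
  let S : Set (Fin n → L) := {w | ∀ σ : Gal(L/K), C σ *ᵥ (fun i => σ (w i)) = w}
  let b : (Fin n → M) → Fin n → L := fun v => ∑ s : M →ₐ[K] L, C (ℓ s) *ᵥ fun i => s (v i)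
  have hbS : ∀ v, b v ∈ S := by
    intro v τ
    let e : (M →ₐ[K] L) ≃ (M →ₐ[K] L) :=
      { toFun := fun s => (τ : L →ₐ[K] L).comp s
        invFun := fun s => ((τ⁻¹ : Gal(L/K)) : L →ₐ[K] L).comp s
        left_inv := fun s => AlgHom.ext fun m => τ.symm_apply_apply (s m)
        right_inv := fun s => AlgHom.ext fun m => τ.apply_symm_apply (s m) }
    have hτ : (fun i => τ (b v i)) =
        ∑ s : M →ₐ[K] L, (C (ℓ s)).map τ *ᵥ fun i => τ (s (v i)) := by
      ext i
      simp [b, Finset.sum_apply, Matrix.mulVec, dotProduct]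
    rw [hτ, Matrix.mulVec_sum]
    change _ = ∑ s : M →ₐ[K] L, C (ℓ s) *ᵥ fun i => s (v i)
    refine Eq.trans (Finset.sum_congr rfl fun s _ => ?_)
      (e.sum_comp fun s => C (ℓ s) *ᵥ fun i => s (v i))
    rw [Matrix.mulVec_mulVec, ← hmul, hinv (τ * ℓ s) (ℓ (e s))]
    · rfl
    · intro m
      rw [hℓ (e s) m]
      exact congrArg τ (hℓ s m)
  have hspan : Submodule.span L S = ⊤ := by
    by_contra hne
    -- A functional u vanishing on all traces gives, for vectors supported at i, a linear relation
    -- between the embeddings of M. Their independence kills every coefficient; the one at the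
    -- inclusion is the value of u at the i-th unit vector, because C is 1 there.
    obtain ⟨u, hu0, hu⟩ := Submodule.exists_le_ker_of_lt_top _ (lt_top_iff_ne_top.2 hne)
    apply hu0
    have hb0 : ∀ v, u (b v) = 0 := fun v => hu (Submodule.subset_span (hbS v))
    refine LinearMap.pi_ext' fun i => LinearMap.ext_ring ?_
    have hind := (Fintype.linearIndependent_iff.1 (linearIndependent_toLinearMap K M L))
      (fun s => u (C (ℓ s) *ᵥ Pi.single i 1)) (by
        ext m
        have h := hb0 (Pi.single i m)
        have h1 : ∀ s : M →ₐ[K] L, (fun k => s ((Pi.single i m : Fin n → M) k)) =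
            s m • (Pi.single i 1 : Fin n → L) := by
          intro s
          ext k
          by_cases hk : k = i
          · subst hk; simp
          · simp [hk]
        simp only [b, map_sum, h1, Matrix.mulVec_smul, map_smul, smul_eq_mul] at h
        simpa [mul_comm] using h) M.val
    have h1 : C (ℓ M.val) = 1 := hU fun m => hℓ M.val m
    rw [h1, Matrix.one_mulVec] at hind
    simpa using hind
  -- A basis of L^n made of fixed vectors supplies the columns of B.
  obtain ⟨t, ht, hts, hti⟩ := exists_linearIndependent L S
  rw [hspan] at hts
  let β : Module.Basis t L (Fin n → L) := Module.Basis.mk hti (by simpa using hts.ge)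
  let e : t ≃ Fin n := β.indexEquiv (Pi.basisFun L (Fin n))
  let γ := β.reindex e
  have hγ : ∀ i, γ i ∈ S := fun i => by
    simpa [γ, β] using ht (e.symm i).2
  refine ⟨(Matrix.of fun i => γ i)ᵀ, ?_, fun σ => ?_⟩
  · rw [Matrix.det_transpose]
    have h := (Module.Basis.is_basis_iff_det (Pi.basisFun L (Fin n)) (v := γ)).1
      ⟨γ.linearIndependent, γ.span_eq⟩
    rw [Pi.basisFun_det_apply] at h
    exact h.ne_zero
  · ext i j
    exact congrFun (hγ j σ) i

end Hilbert90

/-! ### The Galois action on a base change and its invariants -/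

section GalMap

variable {F : Type u} [Field F] [Differential F]
  {A : Type v} [CommRing A] [Differential A] [Algebra F A] [DifferentialAlgebra F A]
  {L : Type w} [Field L] [Algebra (constants F) L]

omit [Differential A] [DifferentialAlgebra F A]

theorem galMap_tmul (σ : Gal(L/constants F)) (a : A) (l : L) :
    DAut.galMap σ (a ⊗ₜ[constants F] l : BaseChange F A L) = a ⊗ₜ σ l := by
  simp [DAut.galMap, extend]

theorem galMap_mul_apply (σ τ : Gal(L/constants F)) (x : BaseChange F A L) :
    DAut.galMap (σ * τ) x = DAut.galMap σ (DAut.galMap τ x) := by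
  induction x using TensorProduct.induction_on with
  | zero => simp [DAut.galMap]
  | add x y hx hy => simp only [DAut.galMap, map_add] at *; rw [hx, hy]
  | tmul a s => simp [galMap_tmul]

theorem galMap_one_apply (x : BaseChange F A L) :
    DAut.galMap (1 : Gal(L/constants F)) x = x := by
  induction x using TensorProduct.induction_on with
  | zero => simp [DAut.galMap]
  | add x y hx hy => simp only [DAut.galMap, map_add] at *; rw [hx, hy]
  | tmul a s => simp [galMap_tmul]

theorem galMap_inv_galMap (σ : Gal(L/constants F)) (x : BaseChange F A L) :
    DAut.galMap σ⁻¹ (DAut.galMap σ x) = x := by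
  rw [← galMap_mul_apply, inv_mul_cancel, galMap_one_apply]

theorem galMap_galMap_inv (σ : Gal(L/constants F)) (x : BaseChange F A L) :
    DAut.galMap σ (DAut.galMap σ⁻¹ x) = x := by
  rw [← galMap_mul_apply, mul_inv_cancel, galMap_one_apply]

/-- `1 ⊗ σ` as a ring automorphism of `A_L`. -/
def galEquiv (σ : Gal(L/constants F)) : BaseChange F A L ≃+* BaseChange F A L :=
  RingEquiv.ofRingHom (extend F A (σ : L →ₐ[constants F] L)).toRingHom
    (extend F A ((σ⁻¹ : Gal(L/constants F)) : L →ₐ[constants F] L)).toRingHom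
    (RingHom.ext (galMap_galMap_inv σ)) (RingHom.ext (galMap_inv_galMap σ))

/-- A tensor involves finitely many elements of L, and each has an open stabilizer. -/
theorem eventually_galMap_eq [Algebra.IsIntegral (constants F) L] (x : BaseChange F A L) :
    ∀ᶠ σ in nhds (1 : Gal(L/constants F)), DAut.galMap σ x = x := by
  induction x using TensorProduct.induction_on with
  | zero => simp [DAut.galMap]
  | add x y hx hy =>
    filter_upwards [hx, hy] with σ h₁ h₂
    simp only [DAut.galMap, map_add] at *
    rw [h₁, h₂]
  | tmul a s =>
    have h := (stabilizer_isOpen_of_isIntegral (K := constants F) s).mem_nhds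
      (one_mem (MulAction.stabilizer Gal(L/constants F) s))
    filter_upwards [h] with σ hσ
    rw [galMap_tmul]
    exact congrArg _ hσ

/-- In a K-basis of A the action of Γ is coordinatewise on copies of L, so the coordinates of an
invariant lie in K. -/
theorem exists_eq_tmul_one_of_galMap_eq [IsGalois (constants F) L] {x : BaseChange F A L}
    (hx : ∀ σ : Gal(L/constants F), DAut.galMap σ x = x) : ∃ a : A, x = a ⊗ₜ 1 := by
  classical
  let b := Module.Basis.ofVectorSpace (constants F) A
  let e := TensorProduct.equivFinsuppOfBasisLeft (N := L) b
  have he : ∀ (σ : Gal(L/constants F)) (y : BaseChange F A L) i,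
      e (DAut.galMap σ y) i = σ (e y i) := by
    intro σ y i
    induction y using TensorProduct.induction_on with
    | zero => simp [DAut.galMap]
    | add x y hx hy =>
      simp only [DAut.galMap, map_add, Finsupp.add_apply] at *
      rw [hx, hy]
    | tmul a s =>
      rw [galMap_tmul, TensorProduct.equivFinsuppOfBasisLeft_apply_tmul_apply,
        TensorProduct.equivFinsuppOfBasisLeft_apply_tmul_apply, map_smul]
  have hK : ∀ i, ∃ c : constants F, algebraMap (constants F) L c = e x i := fun i =>
    (InfiniteGalois.mem_range_algebraMap_iff_fixed (e x i)).2 fun σ => by rw [← he, hx]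
  choose c hc using hK
  refine ⟨(e x).sum fun i _ => c i • b i, ?_⟩
  refine (e.symm_apply_apply x).symm.trans ?_
  rw [TensorProduct.equivFinsuppOfBasisLeft_symm_apply, Finsupp.sum, Finsupp.sum,
    TensorProduct.sum_tmul]
  refine Finset.sum_congr rfl fun i _ => ?_
  rw [← hc i, TensorProduct.smul_tmul, Algebra.algebraMap_eq_smul_one]

end GalMap

/-! ### Constants of `E_L`, and `E_L` as a field -/

section Constants

variable {F : Type u} [Field F] [Differential F]
  {E : Type v} [Field E] [Differential E] [Algebra F E] [DifferentialAlgebra F E]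
  {L : Type w} [Field L] [Algebra (constants F) L]

theorem galMap_deriv (σ : Gal(L/constants F)) (x : BaseChange F E L) :
    DAut.galMap σ x′ = (DAut.galMap σ x)′ := DAut.extend_deriv _ x

/-- In a K-basis of L the derivation is coordinatewise on copies of E, whose constants come from K.
-/
theorem exists_eq_one_tmul_of_deriv_eq_zero
    (hE : ∀ x : E, x′ = 0 → ∃ c : constants F, algebraMap (constants F) E c = x)
    {x : BaseChange F E L} (hx : x′ = 0) : ∃ l : L, x = 1 ⊗ₜ l := by
  classical
  let b := Module.Basis.ofVectorSpace (constants F) L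
  let e := TensorProduct.equivFinsuppOfBasisRight (M := E) b
  have he : ∀ (y : BaseChange F E L) i, e (y′) i = (e y i)′ := by
    intro y i
    induction y using TensorProduct.induction_on with
    | zero => simp
    | add x y hx hy => simp only [map_add, Finsupp.add_apply, hx, hy]
    | tmul a s =>
      rw [deriv_tmul, TensorProduct.equivFinsuppOfBasisRight_apply_tmul_apply,
        TensorProduct.equivFinsuppOfBasisRight_apply_tmul_apply]
      exact ((derivLinear F E).map_smul _ a).symm
  have hK : ∀ i, ∃ c : constants F, algebraMap (constants F) E c = e x i := fun i =>
    hE _ (by rw [← he, hx]; simp)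
  choose c hc using hK
  refine ⟨(e x).sum fun i _ => c i • b i, ?_⟩
  refine (e.symm_apply_apply x).symm.trans ?_
  rw [TensorProduct.equivFinsuppOfBasisRight_symm_apply, Finsupp.sum, Finsupp.sum,
    TensorProduct.tmul_sum]
  refine Finset.sum_congr rfl fun i _ => ?_
  rw [← hc i, Algebra.algebraMap_eq_smul_one, TensorProduct.smul_tmul]

/-- Reducedness can be tested on the finitely generated subalgebras of L. These are separable field
extensions of finite type, hence remain unramified, and so reduced, over A. -/
theorem isReduced_tensorProduct_of_isSeparable (K A L : Type*) [Field K] [Field A] [Algebra K A]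
    [Field L] [Algebra K L] [Algebra.IsSeparable K L] : IsReduced (A ⊗[K] L) := by
  refine IsReduced.tensorProduct_of_flat_of_forall_fg fun B hB => ?_
  let B' : IntermediateField K L := B.toIntermediateField'
    (B.isField_of_algebraic)
  have : Algebra.FormallyEtale K B' := Algebra.FormallyEtale.of_isSeparable K B'
  have : Algebra.FiniteType K B' := (Subalgebra.fg_iff_finiteType B).1 hB
  exact Algebra.FormallyUnramified.isReduced_of_field A (A ⊗[K] B')

/-- Idempotents are constants, so they lie in the field L and are 0 or 1. Algebraicity over E
yields, for each x, an idempotent that is a multiple of a power of x; it is 0 only if x is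
nilpotent, and otherwise x is a unit. -/
theorem isField_baseChange [Algebra.IsSeparable (constants F) L]
    (hE : ∀ x : E, x′ = 0 → ∃ c : constants F, algebraMap (constants F) E c = x) :
    IsField (BaseChange F E L) := by
  have hred : IsReduced (BaseChange F E L) :=
    isReduced_tensorProduct_of_isSeparable (constants F) E L
  have hidem : ∀ e : BaseChange F E L, e * e = e → e = 0 ∨ e = 1 := by
    intro e he
    -- From e′ = 2ee′, multiplying by e gives ee′ = 2ee′; so ee′ = 0 and then e′ = 0.
    have h1 : e′ = e * e′ + e * e′ := by
      conv_lhs => rw [← he, Derivation.leibniz]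
      rfl
    have h2 : e * e′ = 0 := by
      have h3 : e * e′ = e * e * e′ + e * e * e′ := by
        conv_lhs => rw [h1]
        ring
      rw [he] at h3
      simpa using h3
    rw [h2, add_zero] at h1
    obtain ⟨l, rfl⟩ := exists_eq_one_tmul_of_deriv_eq_zero hE h1
    have hinj : Function.Injective (Algebra.TensorProduct.includeRight :
      L →ₐ[constants F] BaseChange F E L) :=
        (Algebra.TensorProduct.includeRight : L →ₐ[constants F] E ⊗[constants F] L).injective
    have h4 : l * l = l := hinj (by simpa using he)
    rcases eq_or_ne l 0 with h | h
    · simp [h]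
    · right
      rw [mul_left_cancel₀ h (h4.trans (mul_one l).symm), Algebra.TensorProduct.one_def]
  have hpow : ∀ x : BaseChange F E L,
      ∃ (n : ℕ) (q : BaseChange F E L), x ^ n = x ^ (n + 1) * q := by
    intro x
    have hx : IsIntegral E x := Algebra.IsIntegral.isIntegral x
    obtain ⟨p, hp0, hp⟩ : ∃ p : Polynomial E, p ≠ 0 ∧ Polynomial.aeval x p = 0 :=
      ⟨minpoly E x, minpoly.ne_zero hx, minpoly.aeval E x⟩
    obtain ⟨q, hq, hq0⟩ := Polynomial.exists_eq_pow_rootMultiplicity_mul_and_not_dvd p hp0 0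
    generalize p.rootMultiplicity 0 = n at hq
    rw [map_zero, sub_zero] at hq hq0
    rw [Polynomial.X_dvd_iff] at hq0
    refine ⟨n, -(algebraMap E _ (q.coeff 0)⁻¹ * Polynomial.aeval x q.divX), ?_⟩
    -- The minimal polynomial is X^n q with q(0) ≠ 0; dividing by q(0) expresses x^n as a multiple
    -- of x^(n+1).
    have h1 : x ^ n * (x * Polynomial.aeval x q.divX + algebraMap E _ (q.coeff 0)) = 0 := by
      have h2 := congrArg (Polynomial.aeval x) (Polynomial.X_mul_divX_add q)
      simp only [map_add, map_mul, Polynomial.aeval_X, Polynomial.aeval_C] at h2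
      rw [h2, ← hp, hq, map_mul, map_pow, Polynomial.aeval_X]
    have h3 : algebraMap E (BaseChange F E L) (q.coeff 0) * algebraMap E _ (q.coeff 0)⁻¹ = 1 := by
      rw [← map_mul, mul_inv_cancel₀ hq0, map_one]
    linear_combination algebraMap E (BaseChange F E L) (q.coeff 0)⁻¹ * h1 - x ^ n * h3
  refine ⟨exists_pair_ne _, mul_comm, fun {x} hx => ?_⟩
  obtain ⟨n, q, hq⟩ := hpow x
  have hq' : ∀ k, x ^ n = x ^ (n + k) * q ^ k := by
    intro k
    induction k with
    | zero => simp
    | succ k ih =>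
      calc x ^ n = x ^ n * (x ^ k * q ^ k) := ih.trans (by ring)
        _ = x ^ (n + 1) * q * (x ^ k * q ^ k) := by rw [← hq]
        _ = x ^ (n + (k + 1)) * q ^ (k + 1) := by ring
  -- Idempotence is the relation x^n = x^(2n) q^n multiplied by q^n.
  have hee : (x ^ n * q ^ n) * (x ^ n * q ^ n) = x ^ n * q ^ n := by
    conv_rhs => rw [hq' n]
    ring
  rcases hidem _ hee with h | h
  · refine absurd (eq_zero_of_pow_eq_zero (n := n) ?_) hx
    rw [hq' n, pow_add, mul_assoc, h, mul_zero]
  · exact ⟨x ^ n * q ^ (n + 1), by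
      calc x * (x ^ n * q ^ (n + 1)) = (x ^ (n + 1) * q) * q ^ n := by ring
        _ = 1 := by rw [← hq, h]⟩

end Constants

/-! ### Homomorphisms are determined on the fundamental matrix -/

section Generation

variable {F : Type u} [Field F] [Differential F]
  {E : Type v} [Field E] [Differential E] [Algebra F E] [DifferentialAlgebra F E]
  {L : Type w} [Field L] [Algebra (constants F) L]

omit [Differential F] [DifferentialAlgebra F E] in
-- The locus where φ and ψ agree is a subfield even when B is not a field: nonzero elements of E
-- have invertible images, and inverses are unique.
theorem FundamentalMatrix.Generates.ringHom_ext {X : FundamentalMatrix F E} (hX : X.Generates)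
    {B : Type*} [CommRing B] {φ ψ : E →+* B}
    (hF : ∀ a, φ (algebraMap F E a) = ψ (algebraMap F E a))
    (hW : ∀ i j, φ (X.W i j) = ψ (X.W i j)) : φ = ψ := by
  let M : IntermediateField F E :=
    { RingHom.eqLocus φ ψ with
      algebraMap_mem' := hF
      inv_mem' := fun x hx => by
        change φ x⁻¹ = ψ x⁻¹
        have hx' : φ x = ψ x := hx
        rcases eq_or_ne x 0 with rfl | h0
        · simp
        · have h1 : φ x * φ x⁻¹ = 1 := by rw [← map_mul, mul_inv_cancel₀ h0, map_one]
          have h2 : φ x * ψ x⁻¹ = 1 := by rw [hx', ← map_mul, mul_inv_cancel₀ h0, map_one]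
          exact (IsUnit.of_mul_eq_one _ h1).mul_left_cancel (h1.trans h2.symm) }
  have hM : M = ⊤ := by
    rw [eq_top_iff, ← hX]
    exact IntermediateField.adjoin_le_iff.2 (by rintro _ ⟨p, rfl⟩; exact hW p.1 p.2)
  ext x
  have : x ∈ M := by rw [hM]; trivial
  exact this

omit [Differential E] [DifferentialAlgebra F E] in
theorem baseChange_ringHom_ext {B : Type*} [CommRing B] {φ ψ : BaseChange F E L →+* B}
    (hE : ∀ a : E, φ (a ⊗ₜ 1) = ψ (a ⊗ₜ 1)) (hL : ∀ l : L, φ (1 ⊗ₜ l) = ψ (1 ⊗ₜ l)) : φ = ψ := by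
  refine RingHom.ext fun x => ?_
  induction x using TensorProduct.induction_on with
  | zero => simp
  | add x y hx hy => rw [map_add, map_add, hx, hy]
  | tmul a l =>
    have h : (a ⊗ₜ l : BaseChange F E L) = (a ⊗ₜ 1) * (1 ⊗ₜ l) := by simp
    rw [h, map_mul, map_mul, hE, hL]

theorem FundamentalMatrix.Generates.dRingIso_ext {X : FundamentalMatrix F E} (hX : X.Generates)
    {B : Type*} [CommRing B] [Differential B] {k : BaseChange F F L →+* B}
    {φ ψ : DRingIso (baseMap F E L) k}
    (h : ∀ i j, φ (X.W i j ⊗ₜ 1) = ψ (X.W i j ⊗ₜ 1)) : φ = ψ := by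
  have hF : ∀ (a : F) (l : L), φ (algebraMap F E a ⊗ₜ l) = ψ (algebraMap F E a ⊗ₜ l) :=
    fun a l => by rw [← baseMap_tmul, φ.apply_base, ψ.apply_base]
  have h1 : (φ.toRingEquiv : BaseChange F E L →+* B) = (ψ.toRingEquiv : BaseChange F E L →+* B) :=
    baseChange_ringHom_ext
      (fun a => RingHom.congr_fun (hX.ringHom_ext
        (φ := (φ.toRingEquiv : BaseChange F E L →+* B).comp
          Algebra.TensorProduct.includeLeftRingHom)
        (ψ := (ψ.toRingEquiv : BaseChange F E L →+* B).comp
          Algebra.TensorProduct.includeLeftRingHom) (fun a => hF a 1) h) a)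
      (fun l => by simpa using hF 1 l)
  exact DRingIso.ext_apply fun x => RingHom.congr_fun h1 x

end Generation

/-! ### Automorphisms as matrices of constants -/

section Matrix

variable {F : Type u} [Field F] [Differential F]
  {E : Type v} [Field E] [Differential E] [Algebra F E] [DifferentialAlgebra F E]
  (L : Type w) [Field L] [Algebra (constants F) L]

theorem deriv_matrix_mul {B : Type*} [CommRing B] [Differential B] {n : ℕ}
    (M N : Matrix (Fin n) (Fin n) B) :
    (M * N).map (fun x => x′) = M.map (fun x => x′) * N + M * N.map (fun x => x′) := by
  ext i j
  simp only [Matrix.map_apply, Matrix.mul_apply, Matrix.add_apply, map_sum, Derivation.leibniz,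
    smul_eq_mul, Finset.sum_add_distrib]
  rw [add_comm]
  congr 1
  exact Finset.sum_congr rfl fun _ _ => mul_comm _ _

/-- The matrix `W ⊗ 1` over `E_L`. -/
def FundamentalMatrix.baseMatrix (X : FundamentalMatrix F E) :
    Matrix (Fin X.n) (Fin X.n) (BaseChange F E L) :=
  X.W.map (Algebra.TensorProduct.includeLeftRingHom : E →+* BaseChange F E L)

variable (F E) in
/-- The embedding `L → E_L`. -/
def constMap : L →+* BaseChange F E L :=
  (Algebra.TensorProduct.includeRight : L →ₐ[constants F] BaseChange F E L).toRingHom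

omit [Differential E] [DifferentialAlgebra F E] in
theorem constMap_apply (l : L) : constMap F E L l = 1 ⊗ₜ l := rfl

omit [Differential E] [DifferentialAlgebra F E] in
theorem constMap_injective : Function.Injective (constMap F E L) := (constMap F E L).injective

variable {L}

omit [DifferentialAlgebra F E] in
theorem FundamentalMatrix.isUnit_det_baseMatrix (X : FundamentalMatrix F E) :
    IsUnit (X.baseMatrix L).det := by
  have h : (X.baseMatrix L).det =
      (Algebra.TensorProduct.includeLeftRingHom : E →+* BaseChange F E L) X.W.det :=
    (RingHom.map_det _ _).symm
  rw [h]
  exact (isUnit_iff_ne_zero.2 X.det_ne_zero).map _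

theorem FundamentalMatrix.deriv_baseMatrix (X : FundamentalMatrix F E) :
    (X.baseMatrix L).map (fun x => x′) =
      (X.A.map fun a => baseMap F E L (a ⊗ₜ 1)) * X.baseMatrix L := by
  ext i j
  have h : (X.baseMatrix L i j)′ = ((X.W i j)′ ⊗ₜ 1 : BaseChange F E L) := deriv_tmul F E L _ _
  rw [Matrix.map_apply, h, X.deriv_entry, TensorProduct.sum_tmul, Matrix.mul_apply]
  refine Finset.sum_congr rfl fun k _ => ?_
  rw [Matrix.map_apply, baseMap_tmul]
  simp [baseMatrix]

/-- A differential automorphism of `E_L` over `F_L` acts on the fundamental matrix by right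
multiplication with an invertible matrix of constants. -/
theorem FundamentalMatrix.exists_matrix_map_eq (X : FundamentalMatrix F E)
    (hE : ∀ x : E, x′ = 0 → ∃ c : constants F, algebraMap (constants F) E c = x)
    (φ : DAut F E L) : ∃ C : Matrix (Fin X.n) (Fin X.n) L,
      (X.baseMatrix L).map φ = X.baseMatrix L * C.map (constMap F E L) := by
  set V := X.baseMatrix L with hV
  have hu : IsUnit V.det := X.isUnit_det_baseMatrix
  set D := V⁻¹ * V.map φ with hD
  have hVD : V.map φ = V * D := by rw [hD, ← mul_assoc, Matrix.mul_nonsing_inv _ hu, one_mul]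
  have h1 : (V.map φ).map (fun x => x′) =
      (X.A.map fun a => baseMap F E L (a ⊗ₜ 1)) * V.map φ := by
    have h2 : (V.map φ).map (fun x => x′) = (V.map (fun x => x′)).map φ := by
      ext i j
      exact (φ.apply_deriv _).symm
    rw [h2, X.deriv_baseMatrix]
    have h3 := Matrix.map_mul (L := X.A.map fun a => baseMap F E L (a ⊗ₜ 1)) (M := V)
      (f := (φ.toRingEquiv : BaseChange F E L →+* BaseChange F E L))
    refine h3.trans ?_
    congr 1
    ext i j : 2
    exact φ.apply_base (X.A i j ⊗ₜ 1)
  -- V and V D = φ(V) satisfy the same linear equation, so the Leibniz rule leaves V D′ = 0.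
  have h4 : D.map (fun x => x′) = 0 := by
    have h5 : V * D.map (fun x => x′) = 0 := by
      have h6 := deriv_matrix_mul V D
      rw [← hVD, h1, X.deriv_baseMatrix, hVD, ← mul_assoc] at h6
      exact left_eq_add.1 h6
    calc D.map (fun x => x′) = V⁻¹ * (V * D.map (fun x => x′)) := by
          rw [← mul_assoc, Matrix.nonsing_inv_mul _ hu, one_mul]
      _ = 0 := by rw [h5, mul_zero]
  have h7 : ∀ i j, ∃ l : L, D i j = 1 ⊗ₜ l := fun i j =>
    exists_eq_one_tmul_of_deriv_eq_zero hE (congrFun (congrFun h4 i) j)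
  choose C hC using h7
  refine ⟨Matrix.of C, hVD.trans ?_⟩
  congr 1
  ext i j
  exact hC i j

omit [DifferentialAlgebra F E] in
theorem FundamentalMatrix.eq_of_baseMatrix_mul_eq (X : FundamentalMatrix F E)
    {C D : Matrix (Fin X.n) (Fin X.n) L}
    (h : X.baseMatrix L * C.map (constMap F E L) = X.baseMatrix L * D.map (constMap F E L)) :
    C = D := by
  have h1 := congrArg ((X.baseMatrix L)⁻¹ * ·) h
  simp only [← mul_assoc, Matrix.nonsing_inv_mul _ X.isUnit_det_baseMatrix, one_mul] at h1
  exact Matrix.map_injective (constMap_injective L) h1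

theorem FundamentalMatrix.det_ne_zero_of_map_eq (X : FundamentalMatrix F E) {φ : DAut F E L}
    {C : Matrix (Fin X.n) (Fin X.n) L}
    (h : (X.baseMatrix L).map φ = X.baseMatrix L * C.map (constMap F E L)) : C.det ≠ 0 := by
  intro h0
  have h1 : ((X.baseMatrix L).map φ).det = φ (X.baseMatrix L).det :=
    (RingHom.map_det (φ.toRingEquiv : BaseChange F E L →+* BaseChange F E L) _).symm
  have h2 : (C.map (constMap F E L)).det = constMap F E L C.det :=
    (RingHom.map_det _ _).symm
  have h3 : IsUnit (φ (X.baseMatrix L).det) :=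
    X.isUnit_det_baseMatrix.map (φ.toRingEquiv : BaseChange F E L →+* BaseChange F E L)
  rw [← h1, h, Matrix.det_mul, h2, h0, map_zero, mul_zero] at h3
  exact not_isUnit_zero h3

end Matrix

/-! ### Restricting and extending differential automorphisms -/

namespace DRingIso

variable {T A B : Type*} [CommRing T] [CommRing A] [CommRing B] [Differential A] [Differential B]
  {i : T →+* A} {k : T →+* B}

theorem apply_symm_apply (f : DRingIso i k) (x : B) : f (f.symm x) = x :=
  f.toRingEquiv.apply_symm_apply x

theorem symm_apply_apply (f : DRingIso i k) (x : A) : f.symm (f x) = x :=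
  f.toRingEquiv.symm_apply_apply x

theorem injective (f : DRingIso i k) : Function.Injective f := f.toRingEquiv.injective

theorem apply_mul (f : DRingIso i k) (x y : A) : f (x * y) = f x * f y := map_mul f.toRingEquiv x y

theorem apply_add (f : DRingIso i k) (x y : A) : f (x + y) = f x + f y := map_add f.toRingEquiv x y

/-- An automorphism that preserves a differential subring restricts to it. -/
theorem exists_restrict (j : A →+* B) (hj : Function.Injective j) (hd : ∀ x, j x′ = (j x)′)
    (hb : ∀ t, j (i t) = k t) (φ : DRingIso k k) (h : ∀ x, ∃ y, j y = φ (j x))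
    (h' : ∀ x, ∃ y, j y = φ.symm (j x)) : ∃ g : DRingIso i i, ∀ x, j (g x) = φ (j x) := by
  choose g hg using h
  choose g' hg' using h'
  refine ⟨⟨⟨⟨g, g', fun x => hj ?_, fun x => hj ?_⟩, fun x y => hj ?_, fun x y => hj ?_⟩,
    fun x => hj ?_, fun t => hj ?_⟩, hg⟩
  · rw [hg', hg, symm_apply_apply]
  · rw [hg, hg', apply_symm_apply]
  · change j (g (x * y)) = j (g x * g y)
    rw [hg, map_mul, apply_mul, map_mul, hg, hg]
  · change j (g (x + y)) = j (g x + g y)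
    rw [hg, map_add, apply_add, map_add, hg, hg]
  · change j (g (x′)) = j ((g x)′)
    rw [hg, hd, hd, hg, φ.apply_deriv]
  · change j (g (i t)) = j (i t)
    rw [hg, hb, φ.apply_base]

/-- An automorphism of a differential domain extends to the field of fractions. -/
theorem exists_extend (j : A →+* B) (hj : Function.Injective j) (hd : ∀ x, j x′ = (j x)′)
    (hb : ∀ t, j (i t) = k t) (hB : IsField B)
    (hfrac : ∀ b, ∃ r x, j r ≠ 0 ∧ b * j r = j x) (g : DRingIso i i) :
    ∃ φ : DRingIso k k, ∀ x, φ (j x) = j (g x) := by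
  have := hB.isDomain
  let _ : Algebra A B := j.toAlgebra
  have : IsFractionRing A B :=
    { map_units := fun r => by
        obtain ⟨c, hc⟩ := hB.mul_inv_cancel (a := j r) (by
          have := hB.nontrivial
          have : Nontrivial A := j.domain_nontrivial
          exact (map_ne_zero_iff j hj).2 (nonZeroDivisors.coe_ne_zero r))
        exact IsUnit.of_mul_eq_one c hc
      surj := fun b => by
        obtain ⟨r, x, hr, hx⟩ := hfrac b
        have : IsDomain A := hj.isDomain j
        exact ⟨(x, ⟨r, mem_nonZeroDivisors_of_ne_zero (by rintro rfl; simp at hr)⟩), hx⟩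
      exists_of_eq := fun {x y} h => ⟨1, by rw [hj h]⟩ }
  let φ : B ≃+* B := IsFractionRing.ringEquivOfRingEquiv g.toRingEquiv
  have hφ : ∀ x, φ (j x) = j (g x) := fun x =>
    IsFractionRing.ringEquivOfRingEquiv_algebraMap g.toRingEquiv x
  refine ⟨⟨φ, fun b => ?_, fun t => ?_⟩, hφ⟩
  · change φ (b′) = ((φ b)′)
    -- Write b = x/r. Differentiating b r = x before and after applying φ gives two identities; φ
    -- respects derivatives of elements of A, so cancelling φ(r) gives the claim for b.
    obtain ⟨r, x, hr, hx⟩ := hfrac b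
    have h1 : φ b * φ (j r) = φ (j x) := by rw [← map_mul, hx]
    have h2 : φ b * (φ (j r))′ + φ (j r) * ((φ b)′) = ((φ (j x))′) := by
      rw [← h1, Derivation.leibniz]; rfl
    have h3 : φ b * φ ((j r)′) + φ (j r) * φ (b′) = φ ((j x)′) := by
      rw [← map_mul, ← map_mul, ← map_add, ← hx, Derivation.leibniz]; rfl
    have h4 : ∀ y, φ ((j y)′) = ((φ (j y))′) := fun y => by
      rw [← hd, hφ, hφ, g.apply_deriv, hd]
    rw [h4, h4, ← h2] at h3
    exact mul_left_cancel₀ (by simpa using hr) (add_left_cancel h3)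
  · change φ (k t) = k t
    rw [← hb, hφ, g.apply_base]

end DRingIso

/-! ### Comparing automorphisms of `E_L` and of `R_L` -/

namespace FundamentalMatrix

variable {F : Type u} [Field F] [Differential F]
  {E : Type v} [Field E] [Differential E] [Algebra F E] [DifferentialAlgebra F E]
  {L : Type w} [Field L] [Algebra (constants F) L]
  (X : FundamentalMatrix F E)

omit [DifferentialAlgebra F E] in
theorem incl_tmul (r : X.ring) (l : L) : X.incl L (r ⊗ₜ l) = (r : E) ⊗ₜ l := by
  simp [incl]

omit [DifferentialAlgebra F E] in
theorem incl_injective : Function.Injective (X.incl L) :=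
  Module.Flat.rTensor_preserves_injective_linearMap
    (X.ring.val.restrictScalars (constants F)).toLinearMap Subtype.val_injective

theorem incl_deriv (x : BaseChange F X.ring L) : X.incl L x′ = (X.incl L x)′ := by
  induction x using TensorProduct.induction_on with
  | zero => simp
  | add x y hx hy => simp only [map_add, hx, hy]
  | tmul a s => rw [deriv_tmul, incl_tmul, incl_tmul, deriv_tmul]; rfl

theorem incl_baseMap (t : BaseChange F F L) :
    X.incl L (baseMap F X.ring L t) = baseMap F E L t := by
  induction t using TensorProduct.induction_on with
  | zero => simp
  | add x y hx hy => simp only [map_add, hx, hy]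
  | tmul a s => rw [baseMap_tmul, baseMap_tmul, incl_tmul]; rfl

omit [DifferentialAlgebra F E] in
theorem incl_galMap (σ : Gal(L/constants F)) (x : BaseChange F X.ring L) :
    X.incl L (DAut.galMap σ x) = DAut.galMap σ (X.incl L x) := by
  induction x using TensorProduct.induction_on with
  | zero => simp [DAut.galMap]
  | add x y hx hy => simp only [DAut.galMap, map_add] at *; rw [hx, hy]
  | tmul a s => rw [galMap_tmul, incl_tmul, incl_tmul, galMap_tmul]

variable {X}

/-- As φ sends V to V C with C invertible over L, it sends det(W)⁻¹ ⊗ 1 to det(W)⁻¹ ⊗ det(C)⁻¹, so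
the images of the generators stay in `R_L`. -/
theorem exists_incl_eq (hE : ∀ x : E, x′ = 0 → ∃ c : constants F, algebraMap (constants F) E c = x)
    (φ : DAut F E L) (x : BaseChange F X.ring L) : ∃ y, X.incl L y = φ (X.incl L x) := by
  obtain ⟨C, hC⟩ := X.exists_matrix_map_eq hE φ
  have hdet : C.det ≠ 0 := X.det_ne_zero_of_map_eq hC
  have hW : ∀ i j, X.W i j ∈ X.ring := fun i j => Algebra.subset_adjoin (Or.inl ⟨(i, j), rfl⟩)
  have hi : X.W.det⁻¹ ∈ X.ring := Algebra.subset_adjoin (Or.inr rfl)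
  let φ' : BaseChange F E L →+* BaseChange F E L := φ.toRingEquiv
  have hr : ∀ r ∈ X.ring, φ' (r ⊗ₜ 1) ∈ (X.incl L).range := by
    intro r hr
    induction hr using Algebra.adjoin_induction with
    | mem r hr =>
      rcases hr with ⟨⟨i, j⟩, rfl⟩ | rfl
      · have h := congrFun (congrFun hC i) j
        rw [Matrix.mul_apply] at h
        change φ' (X.W i j ⊗ₜ 1) = _ at h
        rw [h]
        refine Subring.sum_mem _ fun k _ => ⟨(⟨X.W i k, hW i k⟩ : X.ring) ⊗ₜ C k j, ?_⟩
        rw [incl_tmul, Matrix.map_apply, constMap_apply]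
        simp [baseMatrix]
      · refine ⟨(⟨X.W.det⁻¹, hi⟩ : X.ring) ⊗ₜ C.det⁻¹, ?_⟩
        have h1 : φ' (X.W.det ⊗ₜ 1) = X.W.det ⊗ₜ C.det := by
          have h2 := congrArg Matrix.det hC
          rw [Matrix.det_mul] at h2
          have h3 : ((X.baseMatrix L).map φ).det = φ' (X.baseMatrix L).det :=
            (RingHom.map_det φ' _).symm
          have h4 : (C.map (constMap F E L)).det = constMap F E L C.det :=
            (RingHom.map_det _ _).symm
          have h5 : (X.baseMatrix L).det = X.W.det ⊗ₜ 1 :=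
            (RingHom.map_det (Algebra.TensorProduct.includeLeftRingHom : E →+* BaseChange F E L)
              X.W).symm
          rw [h3, h4, h5, constMap_apply] at h2
          rw [h2]
          simp
        have h6 : φ' (X.W.det ⊗ₜ 1) * φ' (X.W.det⁻¹ ⊗ₜ 1) = 1 := by
          rw [← map_mul, Algebra.TensorProduct.tmul_mul_tmul, mul_inv_cancel₀ X.det_ne_zero,
            one_mul, ← Algebra.TensorProduct.one_def, map_one]
        refine (IsUnit.of_mul_eq_one _ h6).mul_left_cancel ?_
        rw [h6, h1, incl_tmul, Algebra.TensorProduct.tmul_mul_tmul,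
          mul_inv_cancel₀ X.det_ne_zero, mul_inv_cancel₀ hdet, Algebra.TensorProduct.one_def]
    | algebraMap a =>
      refine ⟨algebraMap F X.ring a ⊗ₜ 1, ?_⟩
      have h := φ.apply_base (a ⊗ₜ 1)
      rw [baseMap_tmul] at h
      rw [incl_tmul]
      exact h.symm
    | add x y _ _ hx hy => rw [TensorProduct.add_tmul, map_add]; exact add_mem hx hy
    | mul x y _ _ hx hy =>
      have h : ((x * y) ⊗ₜ 1 : BaseChange F E L) = (x ⊗ₜ 1) * (y ⊗ₜ 1) := by simp
      rw [h, map_mul]; exact mul_mem hx hy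
  change φ' _ ∈ (X.incl L).range
  induction x using TensorProduct.induction_on with
  | zero => rw [map_zero, map_zero]; exact zero_mem _
  | add x y hx hy => rw [map_add, map_add]; exact add_mem hx hy
  | tmul r l =>
    have h : ((r : E) ⊗ₜ l : BaseChange F E L) = ((r : E) ⊗ₜ 1) * (1 ⊗ₜ l) := by simp
    have h1 : φ' (1 ⊗ₜ l) = 1 ⊗ₜ l := φ.apply_one_tmul l
    rw [incl_tmul, h, map_mul, h1]
    refine mul_mem (hr r r.2) ⟨1 ⊗ₜ l, incl_tmul X 1 l⟩

omit [DifferentialAlgebra F E] in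
theorem Generates.exists_mul_incl_eq (hX : X.Generates) (z : BaseChange F E L) :
    ∃ r x, X.incl L r ≠ 0 ∧ z * X.incl L r = X.incl L x := by
  -- Denominators are sought in the domain R itself, so that products of them remain nonzero when
  -- sums are brought to a common denominator.
  suffices h : ∃ r : X.ring, r ≠ 0 ∧ ∃ x, z * ((r : E) ⊗ₜ 1) = X.incl L x by
    obtain ⟨r, hr, x, hx⟩ := h
    have h0 : (r : E) ≠ 0 := fun h => hr (Subtype.ext h)
    refine ⟨r ⊗ₜ 1, x, ?_, by rw [incl_tmul, hx]⟩
    rw [incl_tmul]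
    intro h
    have h1 : ((r : E) ⊗ₜ 1 : BaseChange F E L) * ((r : E)⁻¹ ⊗ₜ 1) = 1 := by
      simp [h0, Algebra.TensorProduct.one_def]
    rw [h, zero_mul] at h1
    exact zero_ne_one h1
  induction z using TensorProduct.induction_on with
  | zero => exact ⟨1, one_ne_zero, 0, by simp⟩
  | add z₁ z₂ h₁ h₂ =>
    obtain ⟨r₁, hr₁, x₁, hx₁⟩ := h₁
    obtain ⟨r₂, hr₂, x₂, hx₂⟩ := h₂
    refine ⟨r₁ * r₂, mul_ne_zero hr₁ hr₂, x₁ * (r₂ ⊗ₜ 1) + x₂ * (r₁ ⊗ₜ 1), ?_⟩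
    have h : ((r₁ * r₂ : X.ring) : E) ⊗ₜ[constants F] (1 : L) =
      ((r₁ : E) ⊗ₜ 1) * ((r₂ : E) ⊗ₜ 1) := by simp
    rw [h, map_add, map_mul, map_mul, ← hx₁, ← hx₂, incl_tmul, incl_tmul]
    ring
  | tmul a l =>
    have ha : a ∈ IntermediateField.adjoin F
        (Set.range fun p : Fin X.n × Fin X.n => X.W p.1 p.2) := by rw [hX]; trivial
    obtain ⟨r, hr, s, hs, rfl⟩ := IntermediateField.mem_adjoin_iff_div.1 ha
    have hle := Algebra.adjoin_mono (R := F) (Set.subset_union_left :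
      (Set.range fun p : Fin X.n × Fin X.n => X.W p.1 p.2) ⊆ _ ∪ {(X.W.det)⁻¹})
    by_cases h0 : s = 0
    · exact ⟨1, one_ne_zero, 0, by simp [h0]⟩
    · refine ⟨⟨s, hle hs⟩, fun h => h0 (congrArg Subtype.val h), (⟨r, hle hr⟩ : X.ring) ⊗ₜ l, ?_⟩
      rw [incl_tmul, Algebra.TensorProduct.tmul_mul_tmul, div_mul_cancel₀ _ h0, mul_one]

/-- Restriction from the automorphisms of `E_L` to the automorphisms of `R_L`. -/
theorem exists_restrictEquiv [Algebra.IsSeparable (constants F) L] (hX : X.Generates)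
    (hE : ∀ x : E, x′ = 0 → ∃ c : constants F, algebraMap (constants F) E c = x) :
    ∃ ρ : DAut F E L ≃* X.GaloisGroup L,
      (∀ φ x, X.incl L (ρ φ x) = φ (X.incl L x)) ∧
      ∀ (σ : Gal(L/constants F)) φ, ρ (σ • φ) = σ • ρ φ := by
  have hres : ∀ φ : DAut F E L, ∃ g : X.GaloisGroup L, ∀ x, X.incl L (g x) = φ (X.incl L x) :=
    fun φ => DRingIso.exists_restrict _ X.incl_injective X.incl_deriv X.incl_baseMap φ
      (exists_incl_eq hE φ) (exists_incl_eq hE φ.symm)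
  choose ρ hρ using hres
  have hW : ∀ i j, X.W i j ∈ X.ring := fun i j => Algebra.subset_adjoin (Or.inl ⟨(i, j), rfl⟩)
  have hinj : Function.Injective ρ := by
    intro φ ψ h
    refine hX.dRingIso_ext fun i j => ?_
    have h1 := hρ φ ((⟨X.W i j, hW i j⟩ : X.ring) ⊗ₜ 1)
    rw [h, hρ, incl_tmul] at h1
    exact h1.symm
  -- `E_L` is a field and each of its elements is a fraction over `R_L`, so automorphisms of `R_L`
  -- extend.
  have hsurj : Function.Surjective ρ := by
    intro g
    obtain ⟨φ, hφ⟩ := DRingIso.exists_extend _ X.incl_injective X.incl_deriv X.incl_baseMap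
      (isField_baseChange hE) hX.exists_mul_incl_eq g
    exact ⟨φ, DRingIso.ext_apply fun x => X.incl_injective (by rw [hρ, hφ])⟩
  refine ⟨{ Equiv.ofBijective ρ ⟨hinj, hsurj⟩ with
    map_mul' := fun φ ψ => DRingIso.ext_apply fun x => X.incl_injective ?_ }, hρ, fun σ φ => ?_⟩
  · change X.incl L (ρ (φ * ψ) x) = X.incl L ((ρ φ * ρ ψ) x)
    rw [hρ, DRingIso.mul_apply, DRingIso.mul_apply, hρ, hρ]
  · change ρ (σ • φ) = σ • ρ φ
    refine DRingIso.ext_apply fun x => X.incl_injective ?_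
    rw [← galMap_galMap_inv σ x, hρ, incl_galMap, DAut.smul_apply_galMap, DAut.smul_apply_galMap,
      incl_galMap, incl_galMap, hρ, incl_galMap]

end FundamentalMatrix

/-- Since a(τ) = a(σ) · σ(a(σ⁻¹τ)), triviality near 1 translates to constancy near σ. -/
theorem isLocallyConstant_of_cocycle {Γ M : Type*} [Group Γ] [TopologicalSpace Γ]
    [ContinuousMul Γ] [Group M] [MulDistribMulAction Γ M] {a : Γ → M}
    (hmul : ∀ σ τ, a (σ * τ) = a σ * σ • a τ) (hone : ∀ᶠ σ in nhds (1 : Γ), a σ = 1) :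
    IsLocallyConstant a := by
  rw [IsLocallyConstant.iff_eventually_eq]
  intro σ
  have h : Filter.Tendsto (fun τ => σ⁻¹ * τ) (nhds σ) (nhds 1) := by
    have := (continuous_const_mul σ⁻¹).tendsto σ
    rwa [inv_mul_cancel] at this
  filter_upwards [h.eventually hone] with τ hτ
  have h1 := hmul σ (σ⁻¹ * τ)
  rwa [mul_inv_cancel_left, hτ, smul_one, mul_one] at h1

/-! ### The cocycle of an isomorphism over L, and descent of isomorphisms -/

section Twist

variable {F : Type u} [Field F] [Differential F]
  {E : Type*} [Field E] [Differential E] [Algebra F E] [DifferentialAlgebra F E]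
  {E₁ : Type*} [Field E₁] [Differential E₁] [Algebra F E₁] [DifferentialAlgebra F E₁]
  {E₂ : Type*} [Field E₂] [Differential E₂] [Algebra F E₂] [DifferentialAlgebra F E₂]
  {L : Type w} [Field L] [Algebra (constants F) L]

theorem galMap_baseMap (σ : Gal(L/constants F)) (t : BaseChange F F L) :
    DAut.galMap σ (baseMap F E L t) = baseMap F E L (DAut.galMap σ t) := by
  induction t using TensorProduct.induction_on with
  | zero => simp [DAut.galMap]
  | add x y hx hy => simp only [DAut.galMap, map_add] at *; rw [hx, hy]
  | tmul a s => rw [baseMap_tmul, galMap_tmul, galMap_tmul, baseMap_tmul]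

theorem smul_apply (σ : Gal(L/constants F)) (φ : DAut F E L) (x : BaseChange F E L) :
    (σ • φ) x = DAut.galMap σ (φ (DAut.galMap σ⁻¹ x)) := by
  rw [← DAut.smul_apply_galMap, galMap_galMap_inv]

/-- The automorphism `f⁻¹ ∘ (1 ⊗ σ) ∘ f ∘ (1 ⊗ σ)⁻¹` of `E_L`. -/
def twist (f : DRingIso (baseMap F E L) (baseMap F E₁ L)) (σ : Gal(L/constants F)) :
    DAut F E L where
  toRingEquiv := ((galEquiv σ⁻¹).trans f.toRingEquiv).trans
    ((galEquiv σ).trans f.symm.toRingEquiv)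
  map_deriv x := by
    change f.symm (DAut.galMap σ (f (DAut.galMap σ⁻¹ (x′)))) =
      ((f.symm (DAut.galMap σ (f (DAut.galMap σ⁻¹ x))))′)
    rw [galMap_deriv, f.apply_deriv, galMap_deriv, f.symm.apply_deriv]
  map_base t := by
    change f.symm (DAut.galMap σ (f (DAut.galMap σ⁻¹ (baseMap F E L t)))) = baseMap F E L t
    rw [galMap_baseMap, f.apply_base, galMap_baseMap, galMap_galMap_inv, f.symm.apply_base]

theorem twist_apply (f : DRingIso (baseMap F E L) (baseMap F E₁ L)) (σ : Gal(L/constants F))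
    (x : BaseChange F E L) :
    twist f σ x = f.symm (DAut.galMap σ (f (DAut.galMap σ⁻¹ x))) := rfl

theorem twist_mul (f : DRingIso (baseMap F E L) (baseMap F E₁ L)) (σ τ : Gal(L/constants F)) :
    twist f (σ * τ) = twist f σ * σ • twist f τ :=
  DRingIso.ext_apply fun x => by
    rw [DRingIso.mul_apply, smul_apply, twist_apply, twist_apply, twist_apply, galMap_inv_galMap,
      DRingIso.apply_symm_apply, mul_inv_rev, galMap_mul_apply, galMap_mul_apply]

theorem twist_refl (σ : Gal(L/constants F)) : twist (DRingIso.refl (baseMap F E L)) σ = 1 :=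
  DRingIso.ext_apply fun x => galMap_galMap_inv σ x

theorem twist_trans_left (g : DAut F E L) (f : DRingIso (baseMap F E L) (baseMap F E₁ L))
    (σ : Gal(L/constants F)) : twist (g.trans f) σ = g⁻¹ * twist f σ * σ • g :=
  DRingIso.ext_apply fun x => by
    rw [DRingIso.mul_apply, DRingIso.mul_apply, smul_apply, twist_apply, twist_apply,
      galMap_inv_galMap]
    rfl

/-- An equivariant k moves past 1 ⊗ σ and cancels against its inverse; applied to base changes of
isomorphisms over F. -/
theorem twist_trans_right (f : DRingIso (baseMap F E L) (baseMap F E₁ L))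
    (k : DRingIso (baseMap F E₁ L) (baseMap F E₂ L)) {σ : Gal(L/constants F)}
    (hk : ∀ y, k (DAut.galMap σ y) = DAut.galMap σ (k y)) : twist (f.trans k) σ = twist f σ :=
  DRingIso.ext_apply fun x => by
    rw [twist_apply, twist_apply]
    change f.symm (k.symm (DAut.galMap σ (k (f _)))) = _
    rw [← hk, DRingIso.symm_apply_apply]

/-- Continuity needs only the finitely many entries of W: they determine the twist, and an open
subgroup fixes all their images under f. -/
theorem eventually_twist_eq_one [Algebra.IsIntegral (constants F) L] {X : FundamentalMatrix F E}
    (hX : X.Generates) (f : DRingIso (baseMap F E L) (baseMap F E₁ L)) :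
    ∀ᶠ σ in nhds (1 : Gal(L/constants F)), twist f σ = 1 := by
  have h : ∀ᶠ σ in nhds (1 : Gal(L/constants F)),
      ∀ i j, DAut.galMap σ (f (X.W i j ⊗ₜ 1)) = f (X.W i j ⊗ₜ 1) :=
    Filter.eventually_all.2 fun i => Filter.eventually_all.2 fun j => eventually_galMap_eq _
  filter_upwards [h] with σ hσ
  refine hX.dRingIso_ext fun i j => ?_
  rw [twist_apply, galMap_tmul, map_one, hσ, DRingIso.symm_apply_apply, DRingIso.one_apply]

/-- The cocycle attached to an isomorphism `E_L → E'_L`. -/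
def twistCocycle [Algebra.IsIntegral (constants F) L] {X : FundamentalMatrix F E}
    (hX : X.Generates) (f : DRingIso (baseMap F E L) (baseMap F E₁ L)) :
    Cocycle Gal(L/constants F) (DAut F E L) where
  toFun := twist f
  isLocallyConstant := isLocallyConstant_of_cocycle (twist_mul f) (eventually_twist_eq_one hX f)
  map_mul := twist_mul f

/-- The base change to `L` of an isomorphism over `F`. -/
def baseChangeIso (h : DRingIso (algebraMap F E₁) (algebraMap F E₂)) :
    DRingIso (baseMap F E₁ L) (baseMap F E₂ L) where
  toRingEquiv := (Algebra.TensorProduct.congr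
    ((AlgEquiv.ofRingEquiv (f := h.toRingEquiv) h.map_base).restrictScalars (constants F))
    (AlgEquiv.refl (R := constants F) (A₁ := L))).toRingEquiv
  map_deriv x := by
    change Algebra.TensorProduct.congr _ _ (x′) = ((Algebra.TensorProduct.congr _ _ x)′)
    induction x using TensorProduct.induction_on with
    | zero => simp
    | add x y hx hy => simp only [map_add, hx, hy]
    | tmul a s =>
      rw [deriv_tmul, Algebra.TensorProduct.congr_apply, Algebra.TensorProduct.congr_apply,
        Algebra.TensorProduct.map_tmul, Algebra.TensorProduct.map_tmul, deriv_tmul]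
      exact congrArg (· ⊗ₜ s) (h.apply_deriv a)
  map_base t := by
    change Algebra.TensorProduct.congr _ _ (baseMap F E₁ L t) = _
    induction t using TensorProduct.induction_on with
    | zero => simp
    | add x y hx hy => simp only [map_add, hx, hy]
    | tmul a s =>
      rw [baseMap_tmul, baseMap_tmul, Algebra.TensorProduct.congr_apply,
        Algebra.TensorProduct.map_tmul]
      exact congrArg (· ⊗ₜ s) (h.apply_base a)

theorem baseChangeIso_galMap (h : DRingIso (algebraMap F E₁) (algebraMap F E₂))
    (σ : Gal(L/constants F)) (x : BaseChange F E₁ L) :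
    baseChangeIso h (DAut.galMap σ x) = DAut.galMap σ (baseChangeIso h x) := by
  induction x using TensorProduct.induction_on with
  | zero =>
    have h0 : baseChangeIso (L := L) h 0 = 0 := map_zero (baseChangeIso h).toRingEquiv
    simp [DAut.galMap, h0]
  | add x y hx hy =>
    simp only [DAut.galMap, map_add] at *
    rw [hx, hy]
  | tmul a s =>
    have h1 : ∀ s : L, baseChangeIso h (a ⊗ₜ s) = h a ⊗ₜ s := fun s => rfl
    rw [galMap_tmul, h1, h1, galMap_tmul]

theorem exists_twist_eq_of_iso (h : DRingIso (algebraMap F E₁) (algebraMap F E₂))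
    (f₁ : DRingIso (baseMap F E L) (baseMap F E₁ L))
    (f₂ : DRingIso (baseMap F E L) (baseMap F E₂ L)) :
    ∃ g : DAut F E L, ∀ σ, twist f₂ σ = g⁻¹ * twist f₁ σ * σ • g := by
  let k := baseChangeIso (L := L) h
  -- Chosen so that f₂ = k ∘ f₁ ∘ g with k equivariant.
  let g : DAut F E L := (f₂.trans k.symm).trans f₁.symm
  refine ⟨g, fun σ => ?_⟩
  rw [← twist_trans_left, ← twist_trans_right (g.trans f₁) k (baseChangeIso_galMap h σ)]
  congr 1
  refine DRingIso.ext_apply fun x => ?_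
  change f₂ x = k (f₁ (f₁.symm (k.symm (f₂ x))))
  rw [DRingIso.apply_symm_apply, DRingIso.apply_symm_apply]

/-- Galois descent for isomorphisms. -/
theorem nonempty_iso_of_galMap [IsGalois (constants F) L]
    (k : DRingIso (baseMap F E₁ L) (baseMap F E₂ L))
    (hk : ∀ (σ : Gal(L/constants F)) y, k (DAut.galMap σ y) = DAut.galMap σ (k y)) :
    Nonempty (DRingIso (algebraMap F E₁) (algebraMap F E₂)) := by
  have hk' : ∀ (σ : Gal(L/constants F)) y, k.symm (DAut.galMap σ y) = DAut.galMap σ (k.symm y) :=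
    fun σ y => k.injective (by rw [hk, k.apply_symm_apply, k.apply_symm_apply])
  have h1 : ∀ a : E₁, ∃ b : E₂, k (a ⊗ₜ 1) = b ⊗ₜ 1 := fun a =>
    exists_eq_tmul_one_of_galMap_eq fun σ => by rw [← hk, galMap_tmul, map_one]
  have h2 : ∀ b : E₂, ∃ a : E₁, k.symm (b ⊗ₜ 1) = a ⊗ₜ 1 := fun b =>
    exists_eq_tmul_one_of_galMap_eq fun σ => by rw [← hk', galMap_tmul, map_one]
  choose p hp using h1
  choose q hq using h2
  let j₁ : E₁ →+* BaseChange F E₁ L := Algebra.TensorProduct.includeLeftRingHom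
  let j₂ : E₂ →+* BaseChange F E₂ L := Algebra.TensorProduct.includeLeftRingHom
  have hp' : ∀ a, j₂ (p a) = k (j₁ a) := fun a => (hp a).symm
  have hq' : ∀ b, j₁ (q b) = k.symm (j₂ b) := fun b => (hq b).symm
  refine ⟨⟨⟨⟨p, q, fun x => j₁.injective ?_, fun x => j₂.injective ?_⟩,
    fun x y => j₂.injective ?_, fun x y => j₂.injective ?_⟩,
    fun x => j₂.injective ?_, fun t => j₂.injective ?_⟩⟩
  · rw [hq', hp', k.symm_apply_apply]
  · rw [hp', hq', k.apply_symm_apply]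
  · change j₂ (p (x * y)) = j₂ (p x * p y)
    rw [hp', map_mul, k.apply_mul, map_mul, hp', hp']
  · change j₂ (p (x + y)) = j₂ (p x + p y)
    rw [hp', map_add, k.apply_add, map_add, hp', hp']
  · change j₂ (p (x′)) = j₂ ((p x)′)
    have h3 : ∀ y, j₂ (y′) = ((j₂ y)′) := fun y => (deriv_tmul F E₂ L y 1).symm
    rw [h3, hp', hp', ← k.apply_deriv]
    rfl
  · change j₂ (p (algebraMap F E₁ t)) = j₂ (algebraMap F E₂ t)
    rw [hp']
    have h3 := k.apply_base (t ⊗ₜ 1)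
    rwa [baseMap_tmul, baseMap_tmul] at h3

/-- For f = f₁ ∘ g the twists of f and f₂ coincide, which says exactly that f₂ ∘ f⁻¹ commutes with
every 1 ⊗ σ, so it descends. -/
theorem nonempty_iso_of_twist_eq [IsGalois (constants F) L]
    (f₁ : DRingIso (baseMap F E L) (baseMap F E₁ L))
    (f₂ : DRingIso (baseMap F E L) (baseMap F E₂ L)) (g : DAut F E L)
    (hg : ∀ σ, twist f₂ σ = g⁻¹ * twist f₁ σ * σ • g) :
    Nonempty (DRingIso (algebraMap F E₁) (algebraMap F E₂)) := by
  let f : DRingIso (baseMap F E L) (baseMap F E₁ L) := g.trans f₁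
  refine nonempty_iso_of_galMap (f.symm.trans f₂) fun σ y => ?_
  have h : twist f₂ σ = twist f σ := by rw [hg, twist_trans_left]
  have h1 : twist f₂ σ (DAut.galMap σ (f.symm y)) = twist f σ (DAut.galMap σ (f.symm y)) := by
    rw [h]
  rw [twist_apply, twist_apply, galMap_inv_galMap, f.apply_symm_apply] at h1
  change f₂ (f.symm (DAut.galMap σ y)) = DAut.galMap σ (f₂ (f.symm y))
  rw [← h1, f₂.apply_symm_apply]

end Twist

/-! ### The differential field generated by a fundamental matrix -/

section Model

variable {F : Type u} [Field F] [Differential F]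

/-- The differential subfield generated by a fundamental matrix has a copy in the universe of the
base field. -/
theorem exists_generated_field (Ω : Type w) [Field Ω] [Differential Ω] [Algebra F Ω]
    [DifferentialAlgebra F Ω] (Y : FundamentalMatrix F Ω) :
    ∃ (E' : Type u) (_ : Field E') (_ : Differential E') (_ : Algebra F E')
      (_ : DifferentialAlgebra F E') (W' : Matrix (Fin Y.n) (Fin Y.n) E') (ι : E' →+* Ω),
      IntermediateField.adjoin F (Set.range fun p : Fin Y.n × Fin Y.n => W' p.1 p.2) = ⊤ ∧
      (∀ a, ι (algebraMap F E' a) = algebraMap F Ω a) ∧ (∀ x, ι x′ = (ι x)′) ∧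
      ∀ i j, ι (W' i j) = Y.W i j := by
  let S : Set Ω := Set.range fun p : Fin Y.n × Fin Y.n => Y.W p.1 p.2
  let M : IntermediateField F Ω := IntermediateField.adjoin F S
  have hWM : ∀ i j, Y.W i j ∈ M := fun i j => IntermediateField.subset_adjoin F S ⟨(i, j), rfl⟩
  have hM : ∀ x ∈ M, x′ ∈ M := by
    intro x hx
    induction hx using IntermediateField.adjoin_induction with
    | mem x hx =>
      obtain ⟨p, rfl⟩ := hx
      rw [Y.deriv_entry]
      exact sum_mem fun k _ => mul_mem (M.algebraMap_mem _) (hWM _ _)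
    | algebraMap a => rw [DifferentialAlgebra.deriv_algebraMap]; exact M.algebraMap_mem _
    | add x y _ _ hx hy => rw [map_add]; exact add_mem hx hy
    | inv x hx hx' =>
      rw [Derivation.leibniz_inv]
      exact mul_mem (neg_mem (pow_mem (inv_mem hx) 2)) hx'
    | mul x y hx hy hx' hy' =>
      rw [Derivation.leibniz]
      exact add_mem (mul_mem hx hy') (mul_mem hy hx')
  let _ : Differential M :=
    ⟨Derivation.mk'
      { toFun := fun x => ⟨(x : Ω)′, hM x x.2⟩
        map_add' := fun x y => Subtype.ext (map_add _ (x : Ω) (y : Ω))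
        map_smul' := fun c x => Subtype.ext (by
          change (c • (x : Ω))′ = c • ((x : Ω)′)
          exact Derivation.map_smul _ c (x : Ω)) }
      (fun x y => Subtype.ext (Derivation.leibniz _ (x : Ω) (y : Ω)))⟩
  have : DifferentialAlgebra F M :=
    ⟨fun a => Subtype.ext (DifferentialAlgebra.deriv_algebraMap (B := Ω) a)⟩
  -- Each element is a quotient of two polynomials over F in the entries, so M is an image of a type
  -- in the universe of F.
  have hsmall : Small.{u} M := by
    let P := MvPolynomial (Fin Y.n × Fin Y.n) F
    let q : P × P → Ω := fun p =>
      MvPolynomial.aeval (fun p : Fin Y.n × Fin Y.n => Y.W p.1 p.2) p.1 /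
        MvPolynomial.aeval (fun p : Fin Y.n × Fin Y.n => Y.W p.1 p.2) p.2
    have h : (M : Set Ω) ⊆ Set.range q := fun x hx => by
      obtain ⟨r, s, h⟩ := (IntermediateField.mem_adjoin_range_iff F _ x).1 hx
      exact ⟨(r, s), h.symm⟩
    exact small_subset h
  let e : Shrink.{u} M ≃ₐ[F] M := Shrink.algEquiv F M
  let _ : Differential (Shrink.{u} M) := Differential.equiv e.toRingEquiv
  have he : ∀ x : Shrink.{u} M, e (x′) = ((e x)′) := fun x => e.apply_symm_apply _
  let ι : Shrink.{u} M →ₐ[F] Ω := M.val.comp e.toAlgHom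
  let W' : Matrix (Fin Y.n) (Fin Y.n) (Shrink.{u} M) := fun i j => e.symm ⟨Y.W i j, hWM i j⟩
  have hW' : ∀ i j, ι (W' i j) = Y.W i j := fun i j =>
    congrArg Subtype.val (e.apply_symm_apply _)
  refine ⟨Shrink.{u} M, inferInstance, inferInstance, inferInstance,
    DifferentialAlgebra.equiv e, W', ι, ?_, ι.commutes, fun x => congrArg Subtype.val (he x), hW'⟩
  refine IntermediateField.map_injective ι ?_
  rw [IntermediateField.adjoin_map, ← Set.range_comp]
  have h1 : (⇑ι ∘ fun p : Fin Y.n × Fin Y.n => W' p.1 p.2) = fun p => Y.W p.1 p.2 :=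
    funext fun p => hW' p.1 p.2
  rw [h1]
  change M = _
  ext x
  simp only [IntermediateField.mem_map, IntermediateField.mem_top, true_and]
  exact ⟨fun hx => ⟨e.symm ⟨x, hx⟩, congrArg Subtype.val (e.apply_symm_apply _)⟩,
    fun ⟨y, hy⟩ => hy ▸ (e y).2⟩

/-- Being a field is a proposition here so that the result applies to the tensor product `E_L` with
its given ring structure. -/
theorem exists_generated_field_of_isField (Ω : Type w) [CommRing Ω] (hΩ : IsField Ω)
    [Differential Ω] [Algebra F Ω] [DifferentialAlgebra F Ω] {n : ℕ}
    (A : Matrix (Fin n) (Fin n) F) (W : Matrix (Fin n) (Fin n) Ω) (hW : IsUnit W.det)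
    (hAW : W.map (fun x => x′) = A.map (algebraMap F Ω) * W) :
    ∃ (E' : Type u) (_ : Field E') (_ : Differential E') (_ : Algebra F E')
      (_ : DifferentialAlgebra F E') (Z : FundamentalMatrix F E') (ι : E' →+* Ω),
      Z.Generates ∧ (∀ a, ι (algebraMap F E' a) = algebraMap F Ω a) ∧ (∀ x, ι x′ = (ι x)′) ∧
      ∃ hn : Z.n = n, ∀ i j, ι (Z.W i j) = W (Fin.cast hn i) (Fin.cast hn j) := by
  let fld : Field Ω := hΩ.toField
  obtain ⟨E', i₁, i₂, i₃, i₄, W', ι, h₁, h₂, h₃, h₄⟩ :=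
    @exists_generated_field F _ _ Ω fld ‹_› ‹_› ‹_› ⟨n, A, W, hW.ne_zero, hAW⟩
  have hWι : W'.map ι = W := by ext i j; exact h₄ i j
  have hdet : W'.det ≠ 0 := by
    intro h
    have h5 : ι W'.det = W.det := 
      (RingHom.map_det ι W').trans (congrArg Matrix.det hWι)
    rw [h, map_zero] at h5
    exact hW.ne_zero h5.symm
  have hd : W'.map (fun x => x′) = A.map (algebraMap F E') * W' := by
    ext i j
    apply ι.injective
    have h5 := congrFun (congrFun hAW i) j
    simp only [Matrix.map_apply, Matrix.mul_apply, map_sum, map_mul] at h5 ⊢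
    rw [h₃, h₄, h5]
    exact Finset.sum_congr rfl fun k _ => by rw [h₂, h₄]
  exact ⟨E', i₁, i₂, i₃, i₄, ⟨n, A, W', hdet, hd⟩, ι, h₁, h₂, h₃, rfl, h₄⟩

end Model

/-! ### A criterion for E' ⊗ L → `E_L` to be an isomorphism -/

section Surjective

variable {F : Type u} [Field F] [Differential F]

instance {A : Type v} [CommRing A] [Differential A] [Algebra F A] [DifferentialAlgebra F A]
    {S : Type w} [CommRing S] [Algebra (constants F) S] :
    DifferentialAlgebra F (BaseChange F A S) where
  deriv_algebraMap a := by
    rw [Algebra.TensorProduct.algebraMap_apply, Algebra.TensorProduct.algebraMap_apply, deriv_tmul,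
      DifferentialAlgebra.deriv_algebraMap]

variable {E : Type v} [Field E] [Differential E] [Algebra F E] [DifferentialAlgebra F E]
  {E₁ : Type v} [Field E₁] [Differential E₁] [Algebra F E₁] [DifferentialAlgebra F E₁]
  {L : Type w} [Field L] [Algebra (constants F) L]

/-- A differential homomorphism `E' → E_L` over `F` whose image, together with `L`, contains
`W` induces an isomorphism `E'_L → E_L`. -/
theorem exists_iso_of_ringHom [Algebra.IsSeparable (constants F) L] {X : FundamentalMatrix F E}
    (hX : X.Generates)
    (hE₁ : ∀ x : E₁, x′ = 0 → ∃ c : constants F, algebraMap (constants F) E₁ c = x)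
    (ι : E₁ →+* BaseChange F E L)
    (hF : ∀ a, ι (algebraMap F E₁ a) = algebraMap F (BaseChange F E L) a)
    (hd : ∀ x, ι x′ = (ι x)′)
    (hW : ∀ (S : Subring (BaseChange F E L)), (∀ x, ι x ∈ S) → (∀ l : L, 1 ⊗ₜ l ∈ S) →
      ∀ i j, (X.W i j ⊗ₜ 1) ∈ S) :
    ∃ h : DRingIso (baseMap F E₁ L) (baseMap F E L), ∀ x l, h (x ⊗ₜ l) = ι x * (1 ⊗ₜ l) := by
  have hfield : IsField (BaseChange F E₁ L) := isField_baseChange hE₁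
  let ι' : E₁ →ₐ[constants F] BaseChange F E L :=
    AlgHom.mk ι fun c => by
      change ι (algebraMap F E₁ c) = algebraMap F (BaseChange F E L) c
      exact hF c
  let h : BaseChange F E₁ L →ₐ[constants F] BaseChange F E L :=
    Algebra.TensorProduct.lift ι' Algebra.TensorProduct.includeRight (fun _ _ => Commute.all _ _)
  have hh : ∀ x l, h (x ⊗ₜ l) = ι x * (1 ⊗ₜ l) := fun x l => by simp [h, ι']
  have hinj : Function.Injective h := by
    rw [injective_iff_map_eq_zero]
    intro x hx
    by_contra h0
    obtain ⟨y, hy⟩ := hfield.mul_inv_cancel h0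
    have h1 := congrArg h hy
    rw [map_mul, hx, zero_mul, map_one] at h1
    exact zero_ne_one h1
  have hι : ∀ x, ι x ∈ h.toRingHom.range := fun x => ⟨x ⊗ₜ 1, by
    change h (x ⊗ₜ 1) = ι x
    rw [hh, ← Algebra.TensorProduct.one_def, mul_one]⟩
  have hL : ∀ l : L, 1 ⊗ₜ l ∈ h.toRingHom.range := fun l => ⟨1 ⊗ₜ l, by
    change h (1 ⊗ₜ l) = _
    rw [hh, map_one, one_mul]⟩
  -- The image of h is a field because its source is one. Hence the x in E with x ⊗ 1 in the image
  -- form an intermediate field, which contains W and so is all of E.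
  let M : IntermediateField F E :=
    { h.toRingHom.range.comap
        (Algebra.TensorProduct.includeLeftRingHom : E →+* BaseChange F E L) with
      algebraMap_mem' := fun a => by
        have h1 := hι (algebraMap F E₁ a)
        rwa [hF] at h1
      inv_mem' := fun x hx => by
        obtain ⟨y, hy⟩ : ∃ y, h y = x ⊗ₜ 1 := hx
        change ∃ z, h z = x⁻¹ ⊗ₜ 1
        rcases eq_or_ne x 0 with rfl | hx0
        · exact ⟨0, by simp⟩
        · have hy0 : y ≠ 0 := by
            rintro rfl
            rw [map_zero] at hy
            exact hx0 ((Algebra.TensorProduct.includeLeftRingHom :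
              E →+* BaseChange F E L).injective (hy.symm.trans (map_zero _).symm))
          obtain ⟨z, hz⟩ := hfield.mul_inv_cancel hy0
          refine ⟨z, ?_⟩
          have h1 : h y * h z = 1 := by rw [← map_mul, hz, map_one]
          refine (IsUnit.of_mul_eq_one _ h1).mul_left_cancel ?_
          rw [h1, hy, Algebra.TensorProduct.tmul_mul_tmul, mul_inv_cancel₀ hx0, one_mul,
            Algebra.TensorProduct.one_def] }
  have hM : M = ⊤ := by
    rw [eq_top_iff, ← hX]
    exact IntermediateField.adjoin_le_iff.2 (by rintro _ ⟨p, rfl⟩; exact hW _ hι hL p.1 p.2)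
  have hsurj : Function.Surjective h := by
    intro z
    change z ∈ h.toRingHom.range
    induction z using TensorProduct.induction_on with
    | zero => exact zero_mem _
    | add x y hx hy => exact add_mem hx hy
    | tmul x l =>
      have hx : x ∈ M := by rw [hM]; trivial
      have h1 : (x ⊗ₜ l : BaseChange F E L) = (x ⊗ₜ 1) * (1 ⊗ₜ l) := by simp
      rw [h1]
      exact mul_mem hx (hL l)
  refine ⟨⟨RingEquiv.ofBijective h ⟨hinj, hsurj⟩, fun x => ?_, fun t => ?_⟩, hh⟩
  · change h (x′) = ((h x)′)
    induction x using TensorProduct.induction_on with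
    | zero => simp
    | add x y hx hy => simp only [map_add, hx, hy]
    | tmul a s =>
      rw [deriv_tmul, hh, hh, hd, Derivation.leibniz, deriv_tmul]
      simp [mul_comm]
  · change h (baseMap F E₁ L t) = _
    induction t using TensorProduct.induction_on with
    | zero => simp
    | add x y hx hy => simp only [map_add, hx, hy]
    | tmul a s =>
      rw [baseMap_tmul, baseMap_tmul, hh, hF, Algebra.TensorProduct.algebraMap_apply]
      simp

end Surjective

/-! ### Constructing a form from a cocycle -/

section Descent

variable {F : Type u} [Field F] [Differential F]
  {E : Type u} [Field E] [Differential E] [Algebra F E] [DifferentialAlgebra F E]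
  {L : Type v} [Field L] [Algebra (constants F) L]

/-- Every continuous cocycle with values in the automorphisms of `E_L` comes from a form. -/
theorem exists_form_of_cocycle [IsGalois (constants F) L] {X : FundamentalMatrix F E}
    (hX : X.Generates)
    (hE : ∀ x : E, x′ = 0 → ∃ c : constants F, algebraMap (constants F) E c = x)
    (a : Cocycle Gal(L/constants F) (DAut F E L)) :
    ∃ (E' : Form F E L) (f : DRingIso (baseMap F E L) (baseMap F E'.carrier L)),
      ∀ σ, twist f σ = a.toFun σ := by
  set V := X.baseMatrix L with hV
  have hone : a.toFun 1 = 1 := by simpa using a.map_mul 1 1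
  have hgalV : ∀ σ : Gal(L/constants F), V.map (DAut.galMap σ) = V := fun σ => by
    ext i j
    exact (galMap_tmul σ _ _).trans (by rw [map_one]; rfl)
  choose C hC using fun σ => X.exists_matrix_map_eq hE (a.toFun σ)
  -- The action twisted by a: semilinear over L and trivial on F.
  let ρ : Gal(L/constants F) → BaseChange F E L →+* BaseChange F E L := fun σ =>
    ((galEquiv σ).trans (a.toFun σ).toRingEquiv : BaseChange F E L ≃+* BaseChange F E L)
  have hρ : ∀ σ x, ρ σ x = a.toFun σ (DAut.galMap σ x) := fun σ x => rfl
  have hρL : ∀ σ (l : L), ρ σ (constMap F E L l) = constMap F E L (σ l) := fun σ l => by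
    rw [hρ, constMap_apply, galMap_tmul, DAut.apply_one_tmul, constMap_apply]
  have hρF : ∀ σ (c : F), ρ σ (algebraMap F _ c) = algebraMap F _ c := fun σ c => by
    rw [hρ, Algebra.TensorProduct.algebraMap_apply, galMap_tmul, map_one, ← baseMap_tmul,
      DRingIso.apply_base]
  have hρmap : ∀ σ (B : Matrix (Fin X.n) (Fin X.n) L),
      (B.map (constMap F E L)).map (ρ σ) = (B.map σ).map (constMap F E L) := fun σ B => by
    ext i j
    exact hρL σ _
  have hρV : ∀ σ, V.map (ρ σ) = V * (C σ).map (constMap F E L) := fun σ => by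
    rw [← hC σ]
    conv_rhs => rw [← hV, ← hgalV σ]
    rfl
  have hCmul : ∀ σ τ, C (σ * τ) = C σ * (C τ).map σ := fun σ τ => by
    apply X.eq_of_baseMatrix_mul_eq (L := L)
    rw [← hC, a.map_mul]
    have h1 : (X.baseMatrix L).map (a.toFun σ * σ • a.toFun τ) = (V.map (a.toFun τ)).map (ρ σ) := by
      ext i j
      rw [Matrix.map_apply, DRingIso.mul_apply, smul_apply]
      have h2 : DAut.galMap σ⁻¹ (X.baseMatrix L i j) = V i j :=
        congrFun (congrFun (hgalV σ⁻¹) i) j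
      rw [h2]
      rfl
    rw [h1, hC, Matrix.map_mul, hρV, hρmap, mul_assoc, ← Matrix.map_mul]
  have hC1 : ∀ᶠ σ in nhds (1 : Gal(L/constants F)), C σ = 1 := by
    filter_upwards [(IsLocallyConstant.iff_eventually_eq _).1 a.isLocallyConstant 1] with σ hσ
    apply X.eq_of_baseMatrix_mul_eq (L := L)
    rw [← hC, hσ, hone, Matrix.map_one _ (map_zero _) (map_one _), mul_one]
    rfl
  obtain ⟨B, hB0, hB⟩ := exists_matrix_of_cocycle C hCmul hC1
  set W := V * B.map (constMap F E L) with hWdef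
  have hρW : ∀ σ, W.map (ρ σ) = W := fun σ => by
    rw [hWdef, Matrix.map_mul, hρV, hρmap, mul_assoc, ← Matrix.map_mul, hB]
  have hdet : IsUnit W.det := by
    have h1 : (B.map (constMap F E L)).det = constMap F E L B.det := (RingHom.map_det _ _).symm
    rw [hWdef, Matrix.det_mul, h1]
    exact X.isUnit_det_baseMatrix.mul ((isUnit_iff_ne_zero.2 hB0).map _)
  -- B has constant entries, so W = V B satisfies the equation of V.
  have hderiv : W.map (fun x => x′) = X.A.map (algebraMap F (BaseChange F E L)) * W := by
    have h1 : (B.map (constMap F E L)).map (fun x => x′) = 0 := by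
      ext i j
      exact (deriv_tmul F E L 1 (B i j)).trans (by simp)
    rw [hWdef, deriv_matrix_mul, h1, mul_zero, add_zero, X.deriv_baseMatrix, mul_assoc]
    congr 1
  obtain ⟨E', i₁, i₂, i₃, i₄, Z, ι, hZ, hιF, hιd, hn, hιW⟩ :=
    exists_generated_field_of_isField (BaseChange F E L) (isField_baseChange hE) X.A W hdet hderiv
  have hρι : ∀ σ x, ρ σ (ι x) = ι x := fun σ x => RingHom.congr_fun
    (hZ.ringHom_ext (φ := (ρ σ).comp ι) (ψ := ι)
      (fun c => by rw [RingHom.comp_apply, hιF, hρF])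
      (fun i j => by
        rw [RingHom.comp_apply, hιW]
        exact congrFun (congrFun (hρW σ) _) _)) x
  -- A constant of E' maps to some 1 ⊗ l. The image of E' is fixed by ρ, which acts on L through Γ,
  -- so l is Γ-invariant and lies in K.
  have hE' : ∀ x : E', x′ = 0 → ∃ c : constants F, algebraMap (constants F) E' c = x := by
    intro x hx
    obtain ⟨l, hl⟩ := exists_eq_one_tmul_of_deriv_eq_zero hE (x := ι x) (by
      rw [← hιd, hx, map_zero])
    have h1 : ∀ σ : Gal(L/constants F), σ l = l := fun σ => by
      apply constMap_injective (F := F) (E := E) L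
      have h2 := hρι σ x
      rw [hl] at h2
      rw [← hρL]
      exact h2
    obtain ⟨c, hc⟩ := (InfiniteGalois.mem_range_algebraMap_iff_fixed (k := constants F) l).2 h1
    refine ⟨c, ι.injective ?_⟩
    rw [hl, ← hc]
    refine (hιF c).trans ?_
    exact Algebra.TensorProduct.algebraMap_apply' c
  obtain ⟨h, hh⟩ := exists_iso_of_ringHom hX hE' ι hιF hιd (by
    intro S hS₁ hS₂ i j
    have hVW : V = W * (B⁻¹).map (constMap F E L) := by
      rw [hWdef, mul_assoc, ← Matrix.map_mul, Matrix.mul_nonsing_inv _ (isUnit_iff_ne_zero.2 hB0),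
        Matrix.map_one _ (map_zero _) (map_one _), mul_one]
    have h1 : V i j ∈ S := by
      rw [hVW, Matrix.mul_apply]
      refine S.sum_mem fun k _ => S.mul_mem ?_ (hS₂ _)
      have h2 := hιW (Fin.cast hn.symm i) (Fin.cast hn.symm k)
      exact h2 ▸ hS₁ _
    exact h1)
  refine ⟨{ carrier := E', isPicardVessiot := ⟨⟨Z, hZ⟩, hE'⟩, isForm := ⟨h.symm⟩ }, h.symm,
    fun σ => ?_⟩
  -- h carries 1 ⊗ σ to ρ_σ; hence the twist of h⁻¹ is ρ_σ ∘ (1 ⊗ σ)⁻¹ = a_σ.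
  have hρh : ∀ y, h (DAut.galMap σ y) = ρ σ (h y) := fun y => by
    have h1 := baseChange_ringHom_ext
      (φ := ((galEquiv σ).trans h.toRingEquiv : BaseChange F E' L →+* BaseChange F E L))
      (ψ := (ρ σ).comp (h.toRingEquiv : BaseChange F E' L →+* BaseChange F E L))
      (fun x => by
        change h (DAut.galMap σ (x ⊗ₜ 1)) = ρ σ (h (x ⊗ₜ 1))
        rw [galMap_tmul, map_one, hh, ← Algebra.TensorProduct.one_def, mul_one, hρι])
      (fun l => by
        change h (DAut.galMap σ (1 ⊗ₜ l)) = ρ σ (h (1 ⊗ₜ l))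
        rw [galMap_tmul, hh, hh, map_one, one_mul, one_mul]
        exact (hρL σ l).symm)
    exact RingHom.congr_fun h1 y
  refine DRingIso.ext_apply fun x => ?_
  change h (DAut.galMap σ (h.symm (DAut.galMap σ⁻¹ x))) = _
  rw [hρh, h.apply_symm_apply, hρ, galMap_galMap_inv]

end Descent

/-! ### Transport of cocycles to G(L) and the classification -/

theorem Cocycle.ext_toFun {Γ M : Type*} [Group Γ] [TopologicalSpace Γ] [Group M]
    [MulDistribMulAction Γ M] {a b : Cocycle Γ M} (h : ∀ σ, a.toFun σ = b.toFun σ) : a = b := by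
  obtain ⟨a, _, _⟩ := a
  obtain ⟨b, _, _⟩ := b
  obtain rfl : a = b := funext h
  rfl

/-- Transport of a continuous cocycle along an equivariant homomorphism. -/
def Cocycle.map {Γ M N : Type*} [Group Γ] [TopologicalSpace Γ] [Group M] [Group N]
    [MulDistribMulAction Γ M] [MulDistribMulAction Γ N] (ρ : M →* N)
    (hρ : ∀ (σ : Γ) m, ρ (σ • m) = σ • ρ m) (a : Cocycle Γ M) : Cocycle Γ N where
  toFun σ := ρ (a.toFun σ)
  isLocallyConstant := a.isLocallyConstant.comp ρ
  map_mul σ τ := by rw [a.map_mul, _root_.map_mul, hρ]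

end PicardVessiot

end

theorem mainTheorem4 {F : Type u} [Field F] [CharZero F] [Differential F]
    {E : Type u} [Field E] [Differential E] [Algebra F E] [DifferentialAlgebra F E]
    (hE : IsPicardVessiot F E) (X : FundamentalMatrix F E) (hX : X.Generates)
    (L : Type v) [Field L] [Algebra (constants F) L] [IsGalois (constants F) L] :
    ∃ Θ : FormClasses F E L ≃ H1 Gal(L/constants F) (X.GaloisGroup L),
      Θ (Quotient.mk _ (Form.self F L hE)) = H1.basePoint Gal(L/constants F) (X.GaloisGroup L) ∧
      ∀ (E' : Form F E L) (f : DRingIso (baseMap F E L) (baseMap F E'.carrier L)),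
        ∃ a : Cocycle Gal(L/constants F) (X.GaloisGroup L),
          (∀ (σ : Gal(L/constants F)) (x : BaseChange F X.ring L),
            X.incl L (a.toFun σ x) =
              f.symm (DAut.galMap σ (f (DAut.galMap σ⁻¹ (X.incl L x))))) ∧
          Θ (Quotient.mk _ E') = Quotient.mk _ a := by
  obtain ⟨ρ, hρ, hρσ⟩ := FundamentalMatrix.exists_restrictEquiv (L := L) hX hE.2
  have hρσ' : ∀ (σ : Gal(L/constants F)) g, ρ.symm (σ • g) = σ • ρ.symm g := fun σ g =>
    ρ.injective (by rw [hρσ, ρ.apply_symm_apply, ρ.apply_symm_apply])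
  let A : ∀ E' : Form F E L, DRingIso (baseMap F E L) (baseMap F E'.carrier L) →
      Cocycle Gal(L/constants F) (X.GaloisGroup L) :=
    fun E' f => (twistCocycle hX f).map ρ.toMonoidHom hρσ
  have hA : ∀ (E₁ E₂ : Form F E L) f₁ f₂, E₁ ≈ E₂ → A E₁ f₁ ≈ A E₂ f₂ := by
    rintro E₁ E₂ f₁ f₂ ⟨h⟩
    obtain ⟨g, hg⟩ := exists_twist_eq_of_iso h f₁ f₂
    refine ⟨ρ g, fun σ => ?_⟩
    change ρ (twist f₂ σ) = (ρ g)⁻¹ * ρ (twist f₁ σ) * σ • ρ g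
    rw [hg, map_mul, map_mul, map_inv, hρσ]
  have hA' : ∀ (E₁ E₂ : Form F E L) f₁ f₂, A E₁ f₁ ≈ A E₂ f₂ → E₁ ≈ E₂ := by
    rintro E₁ E₂ f₁ f₂ ⟨g, hg⟩
    refine nonempty_iso_of_twist_eq f₁ f₂ (ρ.symm g) fun σ => ρ.injective ?_
    have h : ρ (twist f₂ σ) = g⁻¹ * ρ (twist f₁ σ) * σ • g := hg σ
    rw [h, map_mul, map_mul, map_inv, hρσ, ρ.apply_symm_apply]
  let θ : FormClasses F E L → H1 Gal(L/constants F) (X.GaloisGroup L) :=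
    Quotient.lift (fun E' => Quotient.mk _ (A E' E'.isForm.some))
      fun E₁ E₂ h => Quotient.sound (hA E₁ E₂ _ _ h)
  -- The isomorphism picked in the definition of θ is immaterial: any f gives a cohomologous
  -- cocycle.
  have hθ : ∀ (E' : Form F E L) f, θ (Quotient.mk _ E') = Quotient.mk _ (A E' f) :=
    fun E' f => Quotient.sound (hA E' E' _ _ (Setoid.refl _))
  have hbij : Function.Bijective θ := by
    constructor
    · intro x y
      induction x using Quotient.inductionOn with | h E₁
      induction y using Quotient.inductionOn with | h E₂
      intro h
      exact Quotient.sound (hA' E₁ E₂ _ _ (Quotient.exact h))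
    · intro c
      induction c using Quotient.inductionOn with | h a
      obtain ⟨E', f, hf⟩ := exists_form_of_cocycle hX hE.2 (a.map ρ.symm.toMonoidHom hρσ')
      refine ⟨Quotient.mk _ E', (hθ E' f).trans (congrArg _ ?_)⟩
      exact Cocycle.ext_toFun fun σ => (congrArg ρ (hf σ)).trans (ρ.apply_symm_apply _)
  refine ⟨Equiv.ofBijective θ hbij, ?_, fun E' f => ⟨A E' f, fun σ x => ?_, hθ E' f⟩⟩
  · refine (hθ (Form.self F L hE) (DRingIso.refl _)).trans (congrArg _ ?_)
    exact Cocycle.ext_toFun fun σ => (congrArg ρ (twist_refl σ)).trans (map_one ρ)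
  · exact hρ (twist f σ) x
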